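/- Let $(G,+)$ be a finite abelian group. An \emph{indexed sequence} over $G$ is an element of the free commutative monoid on the set of pairs $(g,n)$ with $g\in G\setminus\{0\}$ and $n\in\mathbb{Z}_{\ge 0}$; it is \emph{squarefree} if each pair occurs at most once. The \emph{sum} of $S=\prod_i (g_i,n_i)$ is $\sum_i g_i\in G$ and its \emph{cross number} is $\mathsf{k}(S)=\sum_i 1/\mathrm{ord}(g_i)$. An indexed sequence is \emph{zero-sum} if its sum is $0$, and \emph{irreducible} if it is zero-sum, is not the empty sequence, and has no nonempty proper zero-sum subsequence. A \emph{unique factorization indexed sequence} (UFIS) over $G$ is a squarefree zero-sum indexed sequence that can be written in exactly one way, up to the order of the factors, as a product of irreducible indexed sequences. Define $$\mathsf{K}_1(G)=\max\{\mathsf{k}(S): S \text{ is a UFIS over } G\},$$ and, for a decomposition $G\cong\bigoplus_{i=1}^r C_{p_i^{\alpha_i}}$ with $p_i$ prime (not necessarily distinct) and $\alpha_i\ge 1$, $$\mathsf{K}_1^*(G)=\sum_{i=1}^r\frac{p_i^{\alpha_i}-1}{p_i^{\alpha_i}-p_i^{\alpha_i-1}},$$ which does not depend on the decomposition. \textbf{Proposition.}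 Let $p,q$ be distinct primes, let $\alpha,\beta$ be positive integers, and let $G=C_p\oplus C_{p^\alpha}\oplus C_{q^\beta}$. Then the maximum defining $\mathsf{K}_1(G)$ is attained, and $\mathsf{K}_1(G)=\mathsf{K}_1^*(G)$. -/

import Mathlib

namespace CrossNumber

section Sequences

variable (G : Type*) [AddCommGroup G]

/-- An indexed sequence over `G`: an element of the free commutative monoid on the set of pairs
`(g, n)`, where `g` is a nonzero element of `G` and `n` is a natural number (a label). The monoid
operation is written additively, its identity is `0`, and `T` divides `S` iff `T ≤ S`. -/
abbrev IndexedSeq : Type _ := Multiset ({g : G // g ≠ 0} × ℕ)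

variable {G}

/-- The sum in `G` of the terms of an indexed sequence. -/
def IndexedSeq.sigma (S : IndexedSeq G) : G := (S.map fun x => (x.1 : G)).sum

/-- The cross number: the sum of the inverse orders of the terms. -/
noncomputable def IndexedSeq.crossNumber (S : IndexedSeq G) : ℝ :=
  (S.map fun x => (1 : ℝ) / (addOrderOf (x.1 : G) : ℝ)).sum

/-- Irreducible (minimal zero-sum) indexed sequences: nonempty, zero-sum, and without a nonempty
proper zero-sum subsequence. -/
def IndexedSeq.IsIrreducible (S : IndexedSeq G) : Prop :=
  S ≠ 0 ∧ S.sigma = 0 ∧ ∀ T : IndexedSeq G, T ≤ S → T ≠ 0 → T.sigma = 0 → T = S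

/-- The set of irreducible factorizations of `S`: the formal products (finite multisets) of
irreducible indexed sequences whose product is `S`. -/
def IndexedSeq.factorizations (S : IndexedSeq G) :
    Set (Multiset {U : IndexedSeq G // U.IsIrreducible}) :=
  {F | (F.map Subtype.val).sum = S}

/-- Unique factorization indexed sequences: squarefree zero-sum indexed sequences that have
exactly one irreducible factorization. -/
def IndexedSeq.IsUFIS (S : IndexedSeq G) : Prop :=
  S.Nodup ∧ S.sigma = 0 ∧ ∃! F, F ∈ S.factorizations

variable (G)

/-- The set of all cross numbers of unique factorization indexed sequences over `G`. -/
def ufisCrossNumbers : Set ℝ :=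
  {x | ∃ S : IndexedSeq G, S.IsUFIS ∧ S.crossNumber = x}

/-- The constant `K₁(G)`. -/
noncomputable def K1 : ℝ := sSup (ufisCrossNumbers G)

end Sequences

section K1Star

/-- `G` is the direct sum of the cyclic groups of orders `p i ^ e i`, with `p i` prime and
`0 < e i`. -/
def IsPrimaryDecomposition (G : Type*) [AddCommGroup G] {ι : Type} (p e : ι → ℕ) : Prop :=
  (∀ i, (p i).Prime) ∧ (∀ i, 0 < e i) ∧ Nonempty (G ≃+ ((i : ι) → ZMod (p i ^ e i)))

/-- The sum of `(p ^ e - 1) / (p ^ e - p ^ (e - 1))` over the summands of a decomposition. -/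
noncomputable def K1StarSum {ι : Type} [Fintype ι] (p e : ι → ℕ) : ℝ :=
  ∑ i, ((p i : ℝ) ^ e i - 1) / ((p i : ℝ) ^ e i - (p i : ℝ) ^ (e i - 1))

theorem exists_K1StarSum (G : Type*) [AddCommGroup G] [Finite G] :
    ∃ x : ℝ, ∃ (ι : Type) (_ : Fintype ι) (p e : ι → ℕ),
      IsPrimaryDecomposition G p e ∧ x = K1StarSum p e := by
  classical
  obtain ⟨ι, hι, p, hp, e, ⟨f⟩⟩ := AddCommGroup.equiv_directSum_zmod_of_finite G
  let J := {i : ι // e i ≠ 0}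
  have hsub : ∀ i : ι, e i = 0 → Subsingleton (ZMod (p i ^ e i)) := by
    intro i hi
    rw [hi, pow_zero]
    infer_instance
  let g : ((i : ι) → ZMod (p i ^ e i)) ≃+ ((i : J) → ZMod (p i.1 ^ e i.1)) :=
    AddEquiv.ofBijective
      ({ toFun := fun x i => x i.1, map_zero' := rfl, map_add' := fun _ _ => rfl } :
        ((i : ι) → ZMod (p i ^ e i)) →+ ((i : J) → ZMod (p i.1 ^ e i.1)))
      ⟨fun x y h => by
        funext i
        by_cases hi : e i = 0
        · exact (hsub i hi).elim _ _
        · exact congrFun h ⟨i, hi⟩,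
      fun y => ⟨fun i => if hi : e i ≠ 0 then y ⟨i, hi⟩ else 0, by
        funext i
        exact dif_pos i.2⟩⟩
  exact ⟨_, J, inferInstance, fun i => p i.1, fun i => e i.1,
    ⟨fun i => hp _, fun i => Nat.pos_of_ne_zero i.2,
      ⟨(f.trans (DirectSum.addEquivProd _)).trans g⟩⟩, rfl⟩

/-- The constant `K₁*(G)`: the sum of `(p ^ e - 1) / (p ^ e - p ^ (e - 1))` over the summands of
a decomposition of `G` into cyclic groups of prime power order. It does not depend on the
decomposition, see `K1Star_eq`. -/
noncomputable def K1Star (G : Type*) [AddCommGroup G] [Finite G] : ℝ :=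
  Classical.choose (exists_K1StarSum G)

theorem card_torsion {G : Type*} [AddCommGroup G] {ι : Type} [Fintype ι] {p e : ι → ℕ}
    (h : IsPrimaryDecomposition G p e) {l : ℕ} (hl : l.Prime) (j : ℕ) :
    Nat.card {g : G // l ^ j • g = 0} = l ^ (∑ i, if p i = l then min (e i) j else 0) := by
  classical
  obtain ⟨hp, -, ⟨f⟩⟩ := h
  have e1 : {g : G // l ^ j • g = 0} ≃
      ((i : ι) → {x : ZMod (p i ^ e i) // l ^ j • x = 0}) :=
    { toFun := fun g i => ⟨f g.1 i, by
        have := congrFun (congrArg f g.2) i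
        simpa using this⟩
      invFun := fun x => ⟨f.symm fun i => (x i).1, by
        rw [← map_nsmul]
        have : (l ^ j • fun i => (x i).1 : (i : ι) → ZMod (p i ^ e i)) = 0 := by
          funext i
          exact (x i).2
        rw [this, map_zero]⟩
      left_inv := fun g => Subtype.ext (f.symm_apply_apply g.1)
      right_inv := fun x => by
        funext i
        apply Subtype.ext
        simp }
  rw [Nat.card_congr e1, Nat.card_pi, ← Finset.prod_pow_eq_pow_sum]
  refine Finset.prod_congr rfl fun i _ => ?_
  have : NeZero (p i ^ e i) := ⟨pow_ne_zero _ (hp i).ne_zero⟩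
  have hk := IsAddCyclic.card_nsmulAddMonoidHom_ker (G := ZMod (p i ^ e i)) (l ^ j)
  have hk' : Nat.card {x : ZMod (p i ^ e i) // l ^ j • x = 0} =
      Nat.card (nsmulAddMonoidHom (α := ZMod (p i ^ e i)) (l ^ j)).ker := rfl
  rw [hk', hk, Nat.card_zmod]
  split_ifs with hpl
  · rw [hpl]
    rcases le_total (e i) j with hij | hij
    · rw [min_eq_left hij, Nat.gcd_eq_left (pow_dvd_pow l hij)]
    · rw [min_eq_right hij, Nat.gcd_eq_right (pow_dvd_pow l hij)]
  · rw [pow_zero]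
    exact Nat.Coprime.pow _ _ ((Nat.coprime_primes (hp i) hl).2 hpl)

theorem K1StarSum_eq_sum {ι : Type} [Fintype ι] {p e : ι → ℕ} (hp : ∀ i, (p i).Prime)
    {N : ℕ} (hN : ∀ i, p i < N ∧ e i ≤ N) :
    K1StarSum p e = ∑ l ∈ Nat.primesBelow N, ∑ j ∈ Finset.range N,
      (((∑ i, if p i = l then min (e i) (j + 1) else 0 : ℕ) : ℝ) -
        ((∑ i, if p i = l then min (e i) j else 0 : ℕ) : ℝ)) / (l : ℝ) ^ j := by
  have h1 : ∀ l j : ℕ, (((∑ i, if p i = l then min (e i) (j + 1) else 0 : ℕ) : ℝ) -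
        ((∑ i, if p i = l then min (e i) j else 0 : ℕ) : ℝ)) / (l : ℝ) ^ j =
      ∑ i, if p i = l then (if j < e i then 1 / (p i : ℝ) ^ j else 0) else 0 := by
    intro l j
    push_cast
    rw [← Finset.sum_sub_distrib, Finset.sum_div]
    refine Finset.sum_congr rfl fun i _ => ?_
    split_ifs with h h'
    · rw [h, min_eq_right (by exact_mod_cast h' : ((j : ℝ) + 1) ≤ e i),
        min_eq_right (by exact_mod_cast h'.le)]
      ring
    · rw [not_lt] at h'
      rw [min_eq_left (by exact_mod_cast h'.trans (Nat.le_succ j)),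
        min_eq_left (by exact_mod_cast h')]
      simp
    · simp
  simp_rw [h1]
  have h2 : ∀ l, ∑ j ∈ Finset.range N,
      ∑ i, (if p i = l then (if j < e i then 1 / (p i : ℝ) ^ j else 0) else 0) =
      ∑ i, ∑ j ∈ Finset.range N,
        (if p i = l then (if j < e i then 1 / (p i : ℝ) ^ j else 0) else 0) :=
    fun l => Finset.sum_comm
  simp_rw [h2]
  rw [Finset.sum_comm, K1StarSum]
  refine Finset.sum_congr rfl fun i _ => ?_
  rw [Finset.sum_eq_single_of_mem (p i) (Nat.mem_primesBelow.2 ⟨(hN i).1, hp i⟩)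
    (fun b _ hb => Finset.sum_eq_zero fun j _ => if_neg hb.symm)]
  simp only [if_true]
  rw [← Finset.sum_filter]
  have h3 : (Finset.range N).filter (fun j => j < e i) = Finset.range (e i) := by
    ext j
    have := (hN i).2
    simp only [Finset.mem_filter, Finset.mem_range]
    omega
  rw [h3]
  have hp1 : (1 : ℝ) < p i := by exact_mod_cast (hp i).one_lt
  have hp0 : (0 : ℝ) < p i := by linarith
  rcases Nat.eq_zero_or_pos (e i) with h0 | h0
  · simp [h0]
  obtain ⟨k, hk⟩ : ∃ k, e i = k + 1 := ⟨e i - 1, by omega⟩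
  rw [hk, Nat.add_sub_cancel]
  have h4 : ∀ j : ℕ, (1 : ℝ) / (p i : ℝ) ^ j = ((p i : ℝ)⁻¹) ^ j := by
    intro j
    rw [inv_pow, one_div]
  simp_rw [h4]
  have hne : ((p i : ℝ)⁻¹) ≠ 1 := by
    intro h
    rw [inv_eq_one] at h
    linarith
  rw [geom_sum_eq hne, inv_pow]
  have hpk : (0 : ℝ) < (p i : ℝ) ^ k := pow_pos hp0 k
  have hd : (p i : ℝ) ^ (k + 1) - (p i : ℝ) ^ k ≠ 0 := by
    have : (p i : ℝ) ^ (k + 1) - (p i : ℝ) ^ k = (p i : ℝ) ^ k * (p i - 1) := by ring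
    rw [this]
    exact mul_ne_zero hpk.ne' (by linarith)
  have hd' : (p i : ℝ)⁻¹ - 1 ≠ 0 := sub_ne_zero.2 hne
  rw [div_eq_div_iff hd hd']
  field_simp
  ring

/-- `K₁*(G)` can be computed from any decomposition of `G` into cyclic groups of prime power
order. -/
theorem K1Star_eq {G : Type*} [AddCommGroup G] [Finite G] {ι : Type} [Fintype ι] {p e : ι → ℕ}
    (h : IsPrimaryDecomposition G p e) : K1Star G = K1StarSum p e := by
  obtain ⟨κ, hκ, q, f, h', hx⟩ := Classical.choose_spec (exists_K1StarSum G)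
  have hx' : K1Star G = K1StarSum q f := hx
  rw [hx']
  obtain ⟨N, hN1, hN2⟩ : ∃ N, (∀ i, p i < N ∧ e i ≤ N) ∧ (∀ i, q i < N ∧ f i ≤ N) := by
    refine ⟨(∑ i, (p i + e i)) + (∑ i, (q i + f i)) + 1, fun i => ?_, fun i => ?_⟩
    · have := Finset.single_le_sum (f := fun i => p i + e i) (fun _ _ => Nat.zero_le _)
        (Finset.mem_univ i)
      omega
    · have := Finset.single_le_sum (f := fun i => q i + f i) (fun _ _ => Nat.zero_le _)
        (Finset.mem_univ i)
      omega
  rw [K1StarSum_eq_sum h.1 hN1, K1StarSum_eq_sum h'.1 hN2]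
  refine Finset.sum_congr rfl fun l hl => ?_
  have hlp := (Nat.mem_primesBelow.1 hl).2
  have key : ∀ j, (∑ i, if q i = l then min (f i) j else 0) =
      ∑ i, if p i = l then min (e i) j else 0 := fun j =>
    Nat.pow_right_injective hlp.two_le
      ((card_torsion h' hlp j).symm.trans (card_torsion h hlp j))
  simp_rw [key]

end K1Star

end CrossNumber

/-!
A squarefree zero-sum sequence has a unique factorization exactly when its zero-sum subsequences
are closed under intersection: they then form a Boolean algebra whose atoms are the factors. Both
bounds are proved for finite families with this property (`IsFactorial`), in which zero terms are
allowed and contribute nothing. The property survives replacing a subfamily by its sum (`merge`).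

*Upper bound for the elementary group of rank two.* A factorial family over `C_p ⊕ C_p` has at most
`2 * p` nonzero terms (`IsFactorial.card_ne_zero_le_two_mul`). Let `I` be the augmentation ideal
of the group ring over `𝔽_p`; its power `I ^ (2 * p - 1)` vanishes. A zero-sum subfamily has depth
`m` if some element of `I ^ m` is supported on its subsums and has a nonzero constant coefficient.
Depths of disjoint zero-sum subfamilies add up, since the constant coefficient is multiplicative
there. The product of `1 - X ^ g` over all terms of an atom `U` but one shows that `U` has depth
`|U| - 1`, and for odd `p` an odd depth can be raised by one, by symmetrizing under
`X ^ g ↦ X ^ (-g)`. The point is that two odd atoms whose lengths are prime to `p` jointly have full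
depth (`HasDepth.union_odd_atoms`), because the leading terms of suitable products are linearly
dependent modulo the next power of `I`. So, for odd `p`, at most one unit of depth is lost on all
atoms of length prime to `p` together, and atoms of length divisible by `p` are so long that there
are at most two of them. For `p = 2` the depths of the single atoms suffice. Doubling a family gives
the bound `p` for a group of order `p`.

*Upper bound in general.* Let `G` have exponent dividing `ℓ ^ (a + 1) * r ^ b`, and let the elements
killed by `ℓ ^ a * r ^ b` form a subgroup `H` of index `ℓ`. Merging the terms outside `H` in groups
of at most `ℓ`, those with a small `r`-part of the order first, produces a family over `H` and loses
at most `1 / ℓ ^ a` of the cross number (`IsFactorial.sum_invOrder_le_of_reduction`). Repeating this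
for `q` and then for `p` leads from `C_p ⊕ C_{p ^ α} ⊕ C_{q ^ β}` down to `C_p ⊕ C_p`, where the
cross number is at most `2`.

*Lower bound.* If `h` has order `p` modulo a subgroup that contains a factorial family, then `p - 1`
copies of `h` and `-(p - 1) • h` form one more atom (`HasFactorialFamily.extend`); going up
the cyclic summands layer by layer gives the required cross number.
-/

namespace CrossNumber

/-! ### Families whose zero-sum subfamilies are closed under intersection -/

section Factorial

variable {ι G : Type*} [DecidableEq ι] [AddCommGroup G]

/-- A finite family `f` of elements of `G` is *factorial* if its sum is zero and its zero-sum
subfamilies are closed under intersection. They then form a Boolean algebra, whose atoms are the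
factors of the unique factorization of `f`. Zero values are allowed: they are atoms by
themselves. -/
def IsFactorial [Fintype ι] (f : ι → G) : Prop :=
  ∑ i, f i = 0 ∧ ∀ A B : Finset ι, ∑ i ∈ A, f i = 0 → ∑ i ∈ B, f i = 0 → ∑ i ∈ A ∩ B, f i = 0

namespace IsFactorial

variable [Fintype ι] {f : ι → G}

theorem sum_compl (hf : IsFactorial f) {A : Finset ι} (hA : ∑ i ∈ A, f i = 0) :
    ∑ i ∈ Aᶜ, f i = 0 := by
  have := Finset.sum_add_sum_compl A f
  rwa [hA, zero_add, hf.1] at this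

theorem sum_sdiff (hf : IsFactorial f) {A B : Finset ι} (hA : ∑ i ∈ A, f i = 0)
    (hB : ∑ i ∈ B, f i = 0) : ∑ i ∈ A \ B, f i = 0 := by
  rw [Finset.sdiff_eq_inter_compl]
  exact hf.2 A Bᶜ hA (hf.sum_compl hB)

theorem comp_injective_iff {H : Type*} [AddCommGroup H] {θ : G →+ H}
    (hθ : Function.Injective θ) : IsFactorial (fun i => θ (f i)) ↔ IsFactorial f := by
  have h : ∀ A : Finset ι, ∑ i ∈ A, θ (f i) = 0 ↔ ∑ i ∈ A, f i = 0 := by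
    intro A
    rw [← map_sum, map_eq_zero_iff θ hθ]
  simp only [IsFactorial, h]

end IsFactorial

/-- The family obtained from `f` by replacing the terms with index in `W` by their sum, which is
put at the index `w`; the other indices in `W` get the value `0`. -/
def merge (f : ι → G) (W : Finset ι) (w : ι) (i : ι) : G :=
  if i = w then ∑ j ∈ W, f j else if i ∈ W then 0 else f i

theorem merge_self (f : ι → G) (W : Finset ι) (w : ι) : merge f W w w = ∑ j ∈ W, f j := by
  simp [merge]

theorem merge_of_mem (f : ι → G) {W : Finset ι} {w i : ι} (hi : i ∈ W) (hw : i ≠ w) :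
    merge f W w i = 0 := by
  simp [merge, hi, hw]

theorem merge_of_notMem (f : ι → G) {W : Finset ι} {w i : ι} (hw : w ∈ W) (hi : i ∉ W) :
    merge f W w i = f i := by
  have : i ≠ w := fun h => hi (h ▸ hw)
  simp [merge, hi, this]

theorem sum_merge (f : ι → G) {W : Finset ι} {w : ι} (hw : w ∈ W) (A : Finset ι) :
    ∑ i ∈ A, merge f W w i = ∑ i ∈ (if w ∈ A then A ∪ W else A \ W), f i := by
  rw [← Finset.sum_sdiff (Finset.inter_subset_left : A ∩ W ⊆ A), Finset.sdiff_inter_self_left]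
  have h1 : ∑ i ∈ A \ W, merge f W w i = ∑ i ∈ A \ W, f i :=
    Finset.sum_congr rfl fun i hi => merge_of_notMem f hw (Finset.mem_sdiff.1 hi).2
  rw [h1]
  split_ifs with h
  · rw [Finset.sum_eq_single_of_mem w (Finset.mem_inter.2 ⟨h, hw⟩)
      (fun i hi hne => merge_of_mem f (Finset.mem_inter.1 hi).2 hne), merge_self,
      ← Finset.sum_union Finset.sdiff_disjoint, Finset.sdiff_union_self_eq_union]
  · rw [Finset.sum_eq_zero (s := A ∩ W), add_zero]
    intro i hi
    rw [Finset.mem_inter] at hi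
    exact merge_of_mem f hi.2 fun h' => h (h' ▸ hi.1)

theorem IsFactorial.merge [Fintype ι] {f : ι → G} (hf : IsFactorial f) {W : Finset ι} {w : ι}
    (hw : w ∈ W) : IsFactorial (merge f W w) := by
  refine ⟨?_, fun A B hA hB => ?_⟩
  · rw [sum_merge f hw, if_pos (Finset.mem_univ _), Finset.union_eq_left.2 (Finset.subset_univ _)]
    exact hf.1
  · rw [sum_merge f hw] at hA hB ⊢
    have := hf.2 _ _ hA hB
    convert this using 2
    ext i
    by_cases h1 : w ∈ A <;> by_cases h2 : w ∈ B <;> by_cases h3 : i ∈ W <;>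
      simp [h1, h2, h3]

/-- A family that vanishes outside a minimal zero-sum subfamily `W` is factorial. -/
theorem isFactorial_of_minimal [Fintype ι] {g : ι → G} {W : Finset ι} (h0 : ∀ i ∉ W, g i = 0)
    (hW : ∑ i ∈ W, g i = 0)
    (hmin : ∀ V ⊆ W, ∑ i ∈ V, g i = 0 → V = ∅ ∨ V = W) : IsFactorial g := by
  have hcut : ∀ A : Finset ι, ∑ i ∈ A, g i = ∑ i ∈ A ∩ W, g i := by
    intro A
    refine (Finset.sum_subset Finset.inter_subset_left fun i hi hi' => h0 i fun h => ?_).symm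
    exact hi' (Finset.mem_inter.2 ⟨hi, h⟩)
  refine ⟨by rw [hcut, Finset.univ_inter, hW], fun A B hA hB => ?_⟩
  rw [hcut] at hA hB ⊢
  rw [Finset.inter_inter_distrib_right]
  rcases hmin _ Finset.inter_subset_right hA with h | h
  · simp [h]
  · rw [h, Finset.inter_eq_right.2 Finset.inter_subset_right, hB]

/-- A minimal nonempty zero-sum subfamily. -/
def IsZeroSumAtom (f : ι → G) (U : Finset ι) : Prop :=
  U.Nonempty ∧ ∑ i ∈ U, f i = 0 ∧ ∀ V ⊆ U, V.Nonempty → ∑ i ∈ V, f i = 0 → V = U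

theorem exists_isZeroSumAtom {f : ι → G} {Z : Finset ι} (hZ : ∑ i ∈ Z, f i = 0)
    (hne : Z.Nonempty) : ∃ U ⊆ Z, IsZeroSumAtom f U := by
  induction Z using Finset.strongInduction with
  | H Z ih =>
    by_cases h : ∀ V ⊆ Z, V.Nonempty → ∑ i ∈ V, f i = 0 → V = Z
    · exact ⟨Z, subset_rfl, hne, hZ, h⟩
    · push Not at h
      obtain ⟨V, hVZ, hV, hV0, hVne⟩ := h
      obtain ⟨U, hU, hU'⟩ := ih V (hVZ.ssubset_of_ne hVne) hV0 hV
      exact ⟨U, hU.trans hVZ, hU'⟩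

end Factorial

/-! ### The depth of a zero-sum subfamily in the modular group ring -/

section GroupRing

variable (p : ℕ) {G : Type*} [AddCommGroup G]

/-- The basis element `X ^ g` of the group ring of `G` over `ZMod p`. -/
noncomputable def mono (g : G) : AddMonoidAlgebra (ZMod p) G := AddMonoidAlgebra.single g 1

variable (G) in
/-- The augmentation ideal, generated by the elements `1 - X ^ g`. -/
noncomputable def augIdeal : Ideal (AddMonoidAlgebra (ZMod p) G) :=
  Ideal.span (Set.range fun g : G => 1 - mono p g)

variable (G) in
/-- The coefficient of `X ^ 0`. -/
noncomputable def constCoeff : AddMonoidAlgebra (ZMod p) G →ₗ[ZMod p] ZMod p where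
  toFun F := F.coeff 0
  map_add' _ _ := rfl
  map_smul' _ _ := rfl

variable {p} in
theorem constCoeff_apply (F : AddMonoidAlgebra (ZMod p) G) : constCoeff p G F = F.coeff 0 := rfl

theorem mono_zero : mono p (0 : G) = 1 := rfl

theorem mono_add (g h : G) : mono p (g + h) = mono p g * mono p h := by
  simp [mono, AddMonoidAlgebra.single_mul_single]

theorem mono_sum {ι : Type*} (A : Finset ι) (f : ι → G) :
    mono p (∑ i ∈ A, f i) = ∏ i ∈ A, mono p (f i) := by
  classical
  induction A using Finset.induction_on with
  | empty => simp [mono_zero]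
  | insert i A hi ih => rw [Finset.sum_insert hi, Finset.prod_insert hi, mono_add, ih]

theorem constCoeff_mono (g : G) [Decidable (g = 0)] :
    constCoeff p G (mono p g) = if g = 0 then 1 else 0 := by
  rw [constCoeff_apply, mono, AddMonoidAlgebra.coeff_single, Finsupp.single_apply]

theorem one_sub_mono_mem (g : G) : 1 - mono p g ∈ augIdeal p G :=
  Ideal.subset_span ⟨g, rfl⟩

theorem one_sub_mono_add_sub_mem (g h : G) :
    (1 - mono p (g + h)) - ((1 - mono p g) + (1 - mono p h)) ∈ augIdeal p G ^ 2 := by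
  have : (1 - mono p (g + h)) - ((1 - mono p g) + (1 - mono p h)) =
      -((1 - mono p g) * (1 - mono p h)) := by
    rw [mono_add]; ring
  rw [this, pow_two]
  exact neg_mem (Ideal.mul_mem_mul (one_sub_mono_mem p g) (one_sub_mono_mem p h))

theorem one_sub_mono_neg_add_mem (g : G) :
    (1 - mono p (-g)) + (1 - mono p g) ∈ augIdeal p G ^ 2 := by
  have h := one_sub_mono_add_sub_mem p g (-g)
  rw [add_neg_cancel, mono_zero, sub_self, zero_sub, neg_mem_iff, add_comm] at h
  exact h

variable (G) in
/-- The class of `1 - X ^ g` modulo the square of the augmentation ideal is additive in `g`. -/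
noncomputable def cotangentHom :
    G →+ AddMonoidAlgebra (ZMod p) G ⧸ augIdeal p G ^ 2 where
  toFun g := Ideal.Quotient.mk _ (1 - mono p g)
  map_zero' := by rw [mono_zero, sub_self, map_zero]
  map_add' g h := by
    rw [← map_add, Ideal.Quotient.eq]
    exact one_sub_mono_add_sub_mem p g h

theorem one_sub_mono_smul_sub_mem [Module (ZMod p) G] (a : ZMod p) (g : G) :
    (1 - mono p (a • g)) - a • (1 - mono p g) ∈ augIdeal p G ^ 2 := by
  rw [← Ideal.Quotient.eq]
  exact ZMod.map_smul (cotangentHom p G) a g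

variable (G) in
/-- The involution `X ^ g ↦ X ^ (-g)`. -/
noncomputable def inversion : AddMonoidAlgebra (ZMod p) G →ₐ[ZMod p] AddMonoidAlgebra (ZMod p) G :=
  AddMonoidAlgebra.mapDomainAlgHom (ZMod p) (ZMod p) (negAddMonoidHom : G →+ G)

theorem inversion_mono (g : G) : inversion p G (mono p g) = mono p (-g) := by
  simp [inversion, mono]

theorem mem_span_range_mono (F : AddMonoidAlgebra (ZMod p) G) :
    F ∈ Submodule.span (ZMod p) (Set.range (mono p : G → _)) := by
  induction F using AddMonoidAlgebra.induction_linear with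
  | zero => exact zero_mem _
  | add F F' h h' => exact add_mem h h'
  | single g a =>
    have : AddMonoidAlgebra.single g a = a • mono p g := by
      rw [mono, AddMonoidAlgebra.smul_single, smul_eq_mul, mul_one]
    rw [this]
    exact Submodule.smul_mem _ _ (Submodule.subset_span ⟨g, rfl⟩)

theorem constCoeff_inversion (F : AddMonoidAlgebra (ZMod p) G) :
    constCoeff p G (inversion p G F) = constCoeff p G F := by
  classical
  induction mem_span_range_mono p F using Submodule.span_induction with
  | mem x hx =>
    obtain ⟨g, rfl⟩ := hx
    rw [inversion_mono, constCoeff_mono, constCoeff_mono]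
    simp
  | zero => simp
  | add x y _ _ hx hy => simp [hx, hy]
  | smul a x _ hx => simp [hx]

theorem inversion_sub_self_mem (F : AddMonoidAlgebra (ZMod p) G) :
    inversion p G F - F ∈ augIdeal p G := by
  induction mem_span_range_mono p F using Submodule.span_induction with
  | mem x hx =>
    obtain ⟨g, rfl⟩ := hx
    rw [inversion_mono]
    have : mono p (-g) - mono p g = (1 - mono p g) - (1 - mono p (-g)) := by ring
    rw [this]
    exact sub_mem (one_sub_mono_mem p _) (one_sub_mono_mem p _)
  | zero => simp
  | add x y _ _ hx hy =>
    rw [map_add, add_sub_add_comm]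
    exact add_mem hx hy
  | smul a x _ hx =>
    rw [map_smul, ← smul_sub]
    exact Submodule.smul_of_tower_mem _ a hx

theorem inversion_add_self_mem {F : AddMonoidAlgebra (ZMod p) G} (hF : F ∈ augIdeal p G) :
    inversion p G F + F ∈ augIdeal p G ^ 2 := by
  induction hF using Submodule.span_induction with
  | mem x hx =>
    obtain ⟨g, rfl⟩ := hx
    simp only [map_sub, map_one, inversion_mono]
    exact one_sub_mono_neg_add_mem p g
  | zero => simp
  | add x y _ _ hx hy =>
    rw [map_add, add_add_add_comm]
    exact add_mem hx hy
  | smul r x hx' hx =>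
    have : inversion p G (r • x) + r • x =
        inversion p G r * (inversion p G x + x) - (inversion p G r - r) * x := by
      rw [smul_eq_mul, map_mul]; ring
    rw [this]
    refine sub_mem (Ideal.mul_mem_left _ _ hx) ?_
    rw [pow_two]
    exact Ideal.mul_mem_mul (inversion_sub_self_mem p r) hx'

/-- The involution acts on the `m`-th graded piece of the augmentation filtration by `(-1) ^ m`. -/
theorem inversion_sub_neg_one_pow_mul_mem (m : ℕ) {F : AddMonoidAlgebra (ZMod p) G}
    (hF : F ∈ augIdeal p G ^ m) :
    inversion p G F - (-1) ^ m * F ∈ augIdeal p G ^ (m + 1) := by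
  induction m generalizing F with
  | zero => simpa using inversion_sub_self_mem p F
  | succ m ih =>
    rw [pow_succ'] at hF
    induction hF using Submodule.mul_induction_on' with
    | mem_mul_mem x hx y hy =>
      have : inversion p G (x * y) - (-1) ^ (m + 1) * (x * y) =
          (inversion p G x + x) * inversion p G y - x * (inversion p G y - (-1) ^ m * y) := by
        rw [map_mul]; ring
      have hy' : inversion p G y ∈ augIdeal p G ^ m := by
        have h1 := Ideal.pow_le_pow_right (Nat.le_succ m) (ih hy)
        have h2 := add_mem h1 (Ideal.mul_mem_left _ ((-1) ^ m) hy)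
        simpa using h2
      rw [this]
      refine sub_mem ?_ ?_
      · rw [show m + 1 + 1 = 2 + m by ring, pow_add]
        exact Ideal.mul_mem_mul (inversion_add_self_mem p hx) hy'
      · rw [pow_succ' _ (m + 1)]
        exact Ideal.mul_mem_mul hx (ih hy)
    | add x _ y _ hx hy =>
      have : inversion p G (x + y) - (-1) ^ (m + 1) * (x + y) =
        (inversion p G x - (-1) ^ (m + 1) * x) + (inversion p G y - (-1) ^ (m + 1) * y) := by
        rw [map_add]; ring
      rw [this]
      exact add_mem hx hy

section Depth

variable {ι : Type*}

/-- The span of the elements `X ^ g`, where `g` runs over the subsums of `f` inside `Z`. -/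
noncomputable def subsumSpan (f : ι → G) (Z : Finset ι) :
    Submodule (ZMod p) (AddMonoidAlgebra (ZMod p) G) :=
  Submodule.span (ZMod p) ((fun A => mono p (∑ i ∈ A, f i)) '' {A | A ⊆ Z})

/-- Some element of the `m`-th power of the augmentation ideal is supported on the subsums of `f`
inside `Z` and has a nonzero constant coefficient. -/
def HasDepth (f : ι → G) (Z : Finset ι) (m : ℕ) : Prop :=
  ∃ F ∈ augIdeal p G ^ m, F ∈ subsumSpan p f Z ∧ constCoeff p G F ≠ 0

variable {p} {f : ι → G}

theorem mono_mem_subsumSpan {A Z : Finset ι} (h : A ⊆ Z) :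
    mono p (∑ i ∈ A, f i) ∈ subsumSpan p f Z :=
  Submodule.subset_span ⟨A, h, rfl⟩

theorem mul_mem_subsumSpan [DecidableEq ι] {Z₁ Z₂ : Finset ι} (hd : Disjoint Z₁ Z₂)
    {F₁ F₂ : AddMonoidAlgebra (ZMod p) G} (h₁ : F₁ ∈ subsumSpan p f Z₁)
    (h₂ : F₂ ∈ subsumSpan p f Z₂) : F₁ * F₂ ∈ subsumSpan p f (Z₁ ∪ Z₂) := by
  induction h₁ using Submodule.span_induction with
  | mem x hx =>
    obtain ⟨A, hA, rfl⟩ := hx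
    induction h₂ using Submodule.span_induction with
    | mem y hy =>
      obtain ⟨B, hB, rfl⟩ := hy
      replace hA : A ⊆ Z₁ := hA
      replace hB : B ⊆ Z₂ := hB
      simp only [← mono_add]
      rw [← Finset.sum_union (Finset.disjoint_of_subset_left hA
        (Finset.disjoint_of_subset_right hB hd))]
      exact mono_mem_subsumSpan (Finset.union_subset_union hA hB)
    | zero => rw [mul_zero]; exact zero_mem _
    | add x y _ _ hx hy => rw [mul_add]; exact add_mem hx hy
    | smul a x _ hx => rw [mul_smul_comm]; exact Submodule.smul_mem _ _ hx
  | zero => rw [zero_mul]; exact zero_mem _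
  | add x y _ _ hx hy => rw [add_mul]; exact add_mem hx hy
  | smul a x _ hx => rw [smul_mul_assoc]; exact Submodule.smul_mem _ _ hx

/-- Subsums of disjoint zero-sum subfamilies of a factorial family only cancel if both are zero,
so the constant coefficient is multiplicative on the corresponding spans. -/
theorem constCoeff_mul [Fintype ι] [DecidableEq ι] (hf : IsFactorial f) {Z₁ Z₂ : Finset ι}
    (hd : Disjoint Z₁ Z₂) (hZ₁ : ∑ i ∈ Z₁, f i = 0) {F₁ F₂ : AddMonoidAlgebra (ZMod p) G}
    (h₁ : F₁ ∈ subsumSpan p f Z₁) (h₂ : F₂ ∈ subsumSpan p f Z₂) :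
    constCoeff p G (F₁ * F₂) = constCoeff p G F₁ * constCoeff p G F₂ := by
  classical
  induction h₁ using Submodule.span_induction with
  | mem x hx =>
    obtain ⟨A, hA, rfl⟩ := hx
    induction h₂ using Submodule.span_induction with
    | mem y hy =>
      obtain ⟨B, hB, rfl⟩ := hy
      replace hA : A ⊆ Z₁ := hA
      replace hB : B ⊆ Z₂ := hB
      simp only [← mono_add, constCoeff_mono]
      by_cases hA0 : ∑ i ∈ A, f i = 0
      · simp [hA0]
      · rw [if_neg hA0, zero_mul, if_neg]
        intro h
        have hAB := Finset.disjoint_of_subset_left hA (Finset.disjoint_of_subset_right hB hd)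
        rw [← Finset.sum_union hAB] at h
        have h' := hf.2 _ _ h hZ₁
        apply hA0
        rwa [Finset.union_inter_distrib_right, Finset.inter_eq_left.2 hA,
          Finset.disjoint_iff_inter_eq_empty.1 (Finset.disjoint_of_subset_left hB hd.symm),
          Finset.union_empty] at h'
    | zero => simp
    | add x y _ _ hx hy => rw [mul_add, map_add, hx, hy, map_add, mul_add]
    | smul a x _ hx => rw [mul_smul_comm, map_smul, hx, map_smul, mul_smul_comm]
  | zero => simp
  | add x y _ _ hx hy => rw [add_mul, map_add, hx, hy, map_add, add_mul]
  | smul a x _ hx => rw [smul_mul_assoc, map_smul, hx, map_smul, smul_mul_assoc]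

theorem prod_one_sub_mono (V : Finset ι) :
    ∏ i ∈ V, (1 - mono p (f i)) =
      ∑ A ∈ V.powerset, (-1 : ZMod p) ^ A.card • mono p (∑ i ∈ A, f i) := by
  simp_rw [sub_eq_add_neg, Finset.prod_one_add]
  refine Finset.sum_congr rfl fun A _ => ?_
  rw [Finset.prod_neg, mono_sum, Algebra.smul_def, map_pow, map_neg, map_one]

theorem prod_one_sub_mono_mem_subsumSpan {V Z : Finset ι} (h : V ⊆ Z) :
    ∏ i ∈ V, (1 - mono p (f i)) ∈ subsumSpan p f Z := by
  rw [prod_one_sub_mono]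
  exact sum_mem fun A hA =>
    Submodule.smul_mem _ _ (mono_mem_subsumSpan ((Finset.mem_powerset.1 hA).trans h))

theorem prod_one_sub_mono_mem_pow (V : Finset ι) :
    ∏ i ∈ V, (1 - mono p (f i)) ∈ augIdeal p G ^ V.card := by
  rw [← Finset.prod_const]
  exact Ideal.prod_mem_prod fun i _ => one_sub_mono_mem p (f i)

theorem IsZeroSumAtom.constCoeff_prod_of_ssubset {U V : Finset ι} (hU : IsZeroSumAtom f U)
    (hV : V ⊂ U) : constCoeff p G (∏ i ∈ V, (1 - mono p (f i))) = 1 := by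
  classical
  rw [prod_one_sub_mono, map_sum, Finset.sum_eq_single_of_mem ∅ (Finset.empty_mem_powerset V)]
  · simp [constCoeff_mono]
  · intro A hA hne
    rw [Finset.mem_powerset] at hA
    rw [map_smul, constCoeff_mono, if_neg, smul_zero]
    intro h
    have := hU.2.2 A (hA.trans hV.subset) (Finset.nonempty_iff_ne_empty.2 hne) h
    exact hV.not_subset (this ▸ hA)

theorem IsZeroSumAtom.constCoeff_prod {U : Finset ι} (hU : IsZeroSumAtom f U) :
    constCoeff p G (∏ i ∈ U, (1 - mono p (f i))) = 1 + (-1) ^ U.card := by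
  classical
  rw [prod_one_sub_mono, map_sum, Finset.sum_eq_add_of_mem ∅ U (Finset.empty_mem_powerset U)
    (Finset.mem_powerset_self U) hU.1.ne_empty.symm]
  · simp [constCoeff_mono, hU.2.1]
  · intro A hA hne
    rw [Finset.mem_powerset] at hA
    rw [map_smul, constCoeff_mono, if_neg, smul_zero]
    intro h
    exact hne.2 (hU.2.2 A hA (Finset.nonempty_iff_ne_empty.2 hne.1) h)

namespace HasDepth

theorem mono_right {Z : Finset ι} {m n : ℕ} (h : HasDepth p f Z n) (hmn : m ≤ n) :
    HasDepth p f Z m := by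
  obtain ⟨F, hF, h'⟩ := h
  exact ⟨F, Ideal.pow_le_pow_right hmn hF, h'⟩

theorem empty [Fact p.Prime] : HasDepth p f ∅ 0 := by
  refine ⟨1, by simp, ?_, ?_⟩
  · have := mono_mem_subsumSpan (p := p) (f := f) (Finset.Subset.refl ∅)
    rwa [Finset.sum_empty, mono_zero] at this
  · classical
    rw [← mono_zero, constCoeff_mono, if_pos rfl]
    exact one_ne_zero

theorem union [Fact p.Prime] [Fintype ι] [DecidableEq ι] (hf : IsFactorial f) {Z₁ Z₂ : Finset ι}
    (hd : Disjoint Z₁ Z₂) (hZ₁ : ∑ i ∈ Z₁, f i = 0) {m n : ℕ} (h₁ : HasDepth p f Z₁ m)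
    (h₂ : HasDepth p f Z₂ n) : HasDepth p f (Z₁ ∪ Z₂) (m + n) := by
  obtain ⟨F₁, hF₁, hs₁, hc₁⟩ := h₁
  obtain ⟨F₂, hF₂, hs₂, hc₂⟩ := h₂
  refine ⟨F₁ * F₂, ?_, mul_mem_subsumSpan hd hs₁ hs₂, ?_⟩
  · rw [pow_add]
    exact Ideal.mul_mem_mul hF₁ hF₂
  · rw [constCoeff_mul hf hd hZ₁ hs₁ hs₂]
    exact mul_ne_zero hc₁ hc₂

/-- Symmetrizing under `X ^ g ↦ X ^ (-g)` raises an odd depth by one. -/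
theorem succ_of_odd [Fact p.Prime] [DecidableEq ι] (hp2 : p ≠ 2) {Z : Finset ι}
    (hZ : ∑ i ∈ Z, f i = 0) {m : ℕ} (hm : Odd m) (h : HasDepth p f Z m) :
    HasDepth p f Z (m + 1) := by
  obtain ⟨F, hF, hs, hc⟩ := h
  refine ⟨inversion p G F + F, ?_, add_mem ?_ hs, ?_⟩
  · have := inversion_sub_neg_one_pow_mul_mem p m hF
    rwa [hm.neg_one_pow, neg_one_mul, sub_neg_eq_add] at this
  · clear hF hc
    induction hs using Submodule.span_induction with
    | mem x hx =>
      obtain ⟨A, hA, rfl⟩ := hx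
      replace hA : A ⊆ Z := hA
      have : -∑ i ∈ A, f i = ∑ i ∈ Z \ A, f i := by
        rw [← Finset.sum_sdiff hA, add_eq_zero_iff_eq_neg] at hZ
        exact hZ.symm
      simp only [inversion_mono, this]
      exact mono_mem_subsumSpan Finset.sdiff_subset
    | zero => rw [map_zero]; exact zero_mem _
    | add x y _ _ hx hy => rw [map_add]; exact add_mem hx hy
    | smul a x _ hx => rw [map_smul]; exact Submodule.smul_mem _ _ hx
  · rw [map_add, constCoeff_inversion, ← two_mul]
    refine mul_ne_zero ?_ hc
    intro h2
    have h2' : ((2 : ℕ) : ZMod p) = 0 := by exact_mod_cast h2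
    rw [ZMod.natCast_eq_zero_iff] at h2'
    exact hp2 ((Nat.prime_dvd_prime_iff_eq Fact.out Nat.prime_two).1 h2')

theorem of_atom [Fact p.Prime] [DecidableEq ι] {U : Finset ι} (hU : IsZeroSumAtom f U) :
    HasDepth p f U (U.card - 1) := by
  obtain ⟨u, hu⟩ := hU.1
  refine ⟨∏ i ∈ U.erase u, (1 - mono p (f i)), ?_,
    prod_one_sub_mono_mem_subsumSpan (Finset.erase_subset u U), ?_⟩
  · rw [← Finset.card_erase_of_mem hu]
    exact prod_one_sub_mono_mem_pow _
  · rw [hU.constCoeff_prod_of_ssubset (Finset.erase_ssubset hu)]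
    exact one_ne_zero

/-- An atom with two terms that are different multiples of one element has full depth: the factors
`1 - X ^ (a • z)` and `1 - X ^ (b • z)` are proportional modulo the square of the augmentation
ideal, and the combination of the two products that cancels the leading terms has constant
coefficient `b - a`. -/
theorem of_atom_of_smul [Fact p.Prime] [DecidableEq ι] [Module (ZMod p) G] {U : Finset ι}
    (hU : IsZeroSumAtom f U) {i j : ι} (hi : i ∈ U) (hj : j ∈ U) (hij : i ≠ j) {z : G}
    {a b : ZMod p} (hfi : f i = a • z) (hfj : f j = b • z) (hab : a ≠ b) :
    HasDepth p f U U.card := by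
  have hji : j ∈ U.erase i := Finset.mem_erase.2 ⟨hij.symm, hj⟩
  have hij' : i ∈ U.erase j := Finset.mem_erase.2 ⟨hij, hi⟩
  set h := ∏ k ∈ (U.erase i).erase j, (1 - mono p (f k)) with hh
  have hEi : ∏ k ∈ U.erase j, (1 - mono p (f k)) = (1 - mono p (f i)) * h := by
    rw [hh, Finset.erase_right_comm]
    exact (Finset.mul_prod_erase _ (fun l => 1 - mono p (f l)) hij').symm
  have hEj : ∏ k ∈ U.erase i, (1 - mono p (f k)) = (1 - mono p (f j)) * h := 
    (Finset.mul_prod_erase _ (fun l => 1 - mono p (f l)) hji).symm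
  have hcard : U.card = 2 + ((U.erase i).erase j).card := by
    have h1 := Finset.card_erase_add_one hi
    have h2 := Finset.card_erase_add_one hji
    omega
  refine ⟨b • ((1 - mono p (f i)) * h) - a • ((1 - mono p (f j)) * h), ?_, ?_, ?_⟩
  · have : b • ((1 - mono p (f i)) * h) - a • ((1 - mono p (f j)) * h) =
        (b • ((1 - mono p (a • z)) - a • (1 - mono p z)) -
          a • ((1 - mono p (b • z)) - b • (1 - mono p z))) * h := by
      rw [hfi, hfj]
      simp only [Algebra.smul_def]
      ring
    rw [this, hcard, pow_add]
    exact Ideal.mul_mem_mul (sub_mem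
      (Submodule.smul_of_tower_mem _ b (one_sub_mono_smul_sub_mem p a z))
      (Submodule.smul_of_tower_mem _ a (one_sub_mono_smul_sub_mem p b z)))
      (prod_one_sub_mono_mem_pow _)
  · rw [← hEi, ← hEj]
    exact sub_mem
      (Submodule.smul_mem _ _ (prod_one_sub_mono_mem_subsumSpan (Finset.erase_subset _ _)))
      (Submodule.smul_mem _ _ (prod_one_sub_mono_mem_subsumSpan (Finset.erase_subset _ _)))
  · rw [← hEi, ← hEj, map_sub, map_smul, map_smul,
      hU.constCoeff_prod_of_ssubset (Finset.erase_ssubset hi),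
      hU.constCoeff_prod_of_ssubset (Finset.erase_ssubset hj), smul_eq_mul, smul_eq_mul, mul_one,
      mul_one]
    exact sub_ne_zero.2 hab.symm

/-- If `f k = α • f i + β • f j` with `k` in an odd atom `U₁` and `i`, `j` in another atom `U₂`,
then `1 - X ^ (f k)` can be traded for `α • (1 - X ^ (f i)) + β • (1 - X ^ (f j))` modulo the square
of the augmentation ideal. In the difference of the two products the leading terms cancel, and its
constant coefficient is `-(α + β)`, as the product over the odd atom `U₁` contributes `0`. -/
theorem union_atoms_of_smul_add_smul [Fact p.Prime] [Fintype ι] [DecidableEq ι]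
    [Module (ZMod p) G] (hf : IsFactorial f) {U₁ U₂ : Finset ι} (hU₁ : IsZeroSumAtom f U₁)
    (hU₂ : IsZeroSumAtom f U₂) (hd : Disjoint U₁ U₂) (hodd : Odd U₁.card) {i j k : ι}
    (hi : i ∈ U₂) (hj : j ∈ U₂) (hij : i ≠ j) (hk : k ∈ U₁) {α β : ZMod p}
    (hfk : f k = α • f i + β • f j) (hαβ : α + β ≠ 0) :
    HasDepth p f (U₁ ∪ U₂) (U₁.card + U₂.card - 1) := by
  have hji : j ∈ U₂.erase i := Finset.mem_erase.2 ⟨hij.symm, hj⟩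
  have hij' : i ∈ U₂.erase j := Finset.mem_erase.2 ⟨hij, hi⟩
  set h := ∏ l ∈ (U₂.erase i).erase j, (1 - mono p (f l)) with hh
  set e := ∏ l ∈ U₁.erase k, (1 - mono p (f l)) with he
  have hEi : ∏ l ∈ U₂.erase j, (1 - mono p (f l)) = (1 - mono p (f i)) * h := by
    rw [hh, Finset.erase_right_comm]
    exact (Finset.mul_prod_erase _ (fun l => 1 - mono p (f l)) hij').symm
  have hEj : ∏ l ∈ U₂.erase i, (1 - mono p (f l)) = (1 - mono p (f j)) * h := 
    (Finset.mul_prod_erase _ (fun l => 1 - mono p (f l)) hji).symm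
  have hEk : ∏ l ∈ U₁, (1 - mono p (f l)) = (1 - mono p (f k)) * e := 
    (Finset.mul_prod_erase _ (fun l => 1 - mono p (f l)) hk).symm
  have hcard : U₁.card + U₂.card - 1 = 2 + ((U₁.erase k).card + ((U₂.erase i).erase j).card) := by
    have h1 := Finset.card_erase_add_one hi
    have h2 := Finset.card_erase_add_one hji
    have h3 := Finset.card_erase_add_one hk
    omega
  have hsU₁ : (1 - mono p (f k)) * e ∈ subsumSpan p f U₁ :=
    hEk ▸ prod_one_sub_mono_mem_subsumSpan subset_rfl
  have hse : e ∈ subsumSpan p f U₁ := prod_one_sub_mono_mem_subsumSpan (Finset.erase_subset _ _)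
  have hsh : h ∈ subsumSpan p f U₂ := prod_one_sub_mono_mem_subsumSpan
    ((Finset.erase_subset _ _).trans (Finset.erase_subset _ _))
  have hsi : (1 - mono p (f i)) * h ∈ subsumSpan p f U₂ :=
    hEi ▸ prod_one_sub_mono_mem_subsumSpan (Finset.erase_subset _ _)
  have hsj : (1 - mono p (f j)) * h ∈ subsumSpan p f U₂ :=
    hEj ▸ prod_one_sub_mono_mem_subsumSpan (Finset.erase_subset _ _)
  refine ⟨(1 - mono p (f k)) * e * h - (α • (e * ((1 - mono p (f i)) * h)) +
    β • (e * ((1 - mono p (f j)) * h))), ?_, ?_, ?_⟩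
  · have hlead : (1 - mono p (f k)) - (α • (1 - mono p (f i)) + β • (1 - mono p (f j))) ∈
        augIdeal p G ^ 2 := by
      have := add_mem (one_sub_mono_add_sub_mem p (α • f i) (β • f j))
        (add_mem (one_sub_mono_smul_sub_mem p α (f i)) (one_sub_mono_smul_sub_mem p β (f j)))
      rw [hfk]
      convert this using 1
      abel
    have : (1 - mono p (f k)) * e * h - (α • (e * ((1 - mono p (f i)) * h)) +
        β • (e * ((1 - mono p (f j)) * h))) =
        ((1 - mono p (f k)) - (α • (1 - mono p (f i)) + β • (1 - mono p (f j)))) * (e * h) := by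
      simp only [Algebra.smul_def]
      ring
    rw [this, hcard, pow_add _ 2, pow_add]
    exact Ideal.mul_mem_mul hlead
      (Ideal.mul_mem_mul (prod_one_sub_mono_mem_pow _) (prod_one_sub_mono_mem_pow _))
  · exact sub_mem (mul_mem_subsumSpan hd hsU₁ hsh) (add_mem
      (Submodule.smul_mem _ _ (mul_mem_subsumSpan hd hse hsi))
      (Submodule.smul_mem _ _ (mul_mem_subsumSpan hd hse hsj)))
  · have hci : constCoeff p G ((1 - mono p (f i)) * h) = 1 := by
      rw [← hEi, hU₂.constCoeff_prod_of_ssubset (Finset.erase_ssubset hj)]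
    have hcj : constCoeff p G ((1 - mono p (f j)) * h) = 1 := by
      rw [← hEj, hU₂.constCoeff_prod_of_ssubset (Finset.erase_ssubset hi)]
    have hck : constCoeff p G ((1 - mono p (f k)) * e) = 0 := by
      rw [← hEk, hU₁.constCoeff_prod, hodd.neg_one_pow, add_neg_cancel]
    have hce : constCoeff p G e = 1 := hU₁.constCoeff_prod_of_ssubset (Finset.erase_ssubset hk)
    rw [map_sub, map_add, map_smul, map_smul, constCoeff_mul hf hd hU₁.2.1 hsU₁ hsh,
      constCoeff_mul hf hd hU₁.2.1 hse hsi, constCoeff_mul hf hd hU₁.2.1 hse hsj, hck, hce, hci,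
      hcj]
    simpa [sub_eq_add_neg] using neg_ne_zero.2 hαβ

end HasDepth

end Depth
end GroupRing

/-! ### Factorial families over elementary groups of rank at most two -/

section ElementaryRankTwo

variable {p : ℕ} [Fact p.Prime]

theorem augIdeal_pow_eq_bot : augIdeal p (ZMod p × ZMod p) ^ (2 * p - 1) = ⊥ := by
  have : CharP (AddMonoidAlgebra (ZMod p) (ZMod p × ZMod p)) p :=
    charP_of_injective_algebraMap (algebraMap (ZMod p) _).injective p
  have hnil : ∀ g : ZMod p × ZMod p, (1 - mono p g) ^ p = 0 := by
    intro g
    have h : ∀ n : ℕ, mono p g ^ n = mono p (n • g) := by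
      intro n
      induction n with
      | zero => rw [pow_zero, zero_smul, mono_zero]
      | succ n ih => rw [pow_succ, ih, succ_nsmul, mono_add]
    have hg : p • g = 0 := by ext <;> simp
    rw [sub_pow_char, one_pow, h, hg, mono_zero, sub_self]
  have hle : augIdeal p (ZMod p × ZMod p) ≤
      Ideal.span {1 - mono p (1, 0)} + Ideal.span {1 - mono p (0, 1)} := by
    have hadd : ∀ (J : Ideal (AddMonoidAlgebra (ZMod p) (ZMod p × ZMod p))) (g h : ZMod p × ZMod p),
        1 - mono p g ∈ J → 1 - mono p h ∈ J → 1 - mono p (g + h) ∈ J := by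
      intro J g h hg hh
      have : 1 - mono p (g + h) = (1 - mono p g) + mono p g * (1 - mono p h) := by
        rw [mono_add]; ring
      rw [this]
      exact add_mem hg (Ideal.mul_mem_left _ _ hh)
    have hsmul : ∀ (J : Ideal (AddMonoidAlgebra (ZMod p) (ZMod p × ZMod p))) (g : ZMod p × ZMod p),
        1 - mono p g ∈ J → ∀ n : ℕ, 1 - mono p (n • g) ∈ J := by
      intro J g hg n
      induction n with
      | zero => simp [mono_zero]
      | succ n ih => rw [succ_nsmul]; exact hadd J _ _ ih hg
    rw [augIdeal, Ideal.span_le]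
    rintro _ ⟨g, rfl⟩
    have hg : g = g.1.val • ((1, 0) : ZMod p × ZMod p) + g.2.val • ((0, 1) : ZMod p × ZMod p) := by
      ext <;> simp
    show 1 - mono p g ∈ _
    rw [hg]
    refine hadd _ _ _ (hsmul _ _ ?_ _) (hsmul _ _ ?_ _)
    · exact Ideal.mem_sup_left (Ideal.mem_span_singleton_self _)
    · exact Ideal.mem_sup_right (Ideal.mem_span_singleton_self _)
  rw [eq_bot_iff]
  refine (Ideal.pow_right_mono hle _).trans ?_
  rw [add_pow]
  refine le_of_eq (Finset.sum_eq_zero fun k hk => ?_)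
  have hz : ∀ (g : ZMod p × ZMod p) (n : ℕ), p ≤ n → Ideal.span {1 - mono p g} ^ n = 0 := by
    intro g n hn
    rw [Ideal.span_singleton_pow, pow_eq_zero_of_le hn (hnil g)]
    exact Ideal.span_singleton_eq_bot.2 rfl
  rcases le_or_gt p k with h | h
  · rw [hz _ _ h, zero_mul, zero_mul]
  · rw [hz _ (2 * p - 1 - k) (by omega), mul_zero, zero_mul]

variable {ι : Type*} {f : ι → ZMod p × ZMod p}

theorem HasDepth.lt {Z : Finset ι} {m : ℕ} (h : HasDepth p f Z m) : m < 2 * p - 1 := by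
  by_contra hm
  rw [not_lt] at hm
  obtain ⟨F, hF, -, hc⟩ := h
  have hF' := Ideal.pow_le_pow_right hm hF
  rw [augIdeal_pow_eq_bot, Ideal.mem_bot] at hF'
  exact hc (by rw [hF', map_zero])

theorem exists_smul_or_forall_exists_smul_add_smul {w : ZMod p × ZMod p} (hw : w ≠ 0)
    (v : ZMod p × ZMod p) : (∃ t : ZMod p, v = t • w) ∨ ∀ x, ∃ α β : ZMod p, x = α • w + β • v := by
  obtain ⟨a, b⟩ := w
  obtain ⟨c, d⟩ := v
  by_cases hdet : a * d - b * c = 0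
  · left
    by_cases ha : a = 0
    · have hb : b ≠ 0 := by
        rintro rfl
        exact hw (by rw [ha]; rfl)
      have hc : c = 0 := by simpa [ha, hb] using hdet
      refine ⟨d / b, ?_⟩
      ext
      · simp [ha, hc]
      · simp [hb]
    · refine ⟨c / a, ?_⟩
      ext
      · simp [ha]
      · simp only [Prod.smul_mk, smul_eq_mul]
        field_simp
        linear_combination hdet
  · right
    rintro ⟨x, y⟩
    refine ⟨(x * d - y * c) / (a * d - b * c), (a * y - b * x) / (a * d - b * c), ?_⟩
    ext
    · simp only [Prod.smul_mk, Prod.mk_add_mk, smul_eq_mul]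
      rw [div_mul_eq_mul_div, div_mul_eq_mul_div, ← add_div, eq_div_iff hdet]
      ring
    · simp only [Prod.smul_mk, Prod.mk_add_mk, smul_eq_mul]
      rw [div_mul_eq_mul_div, div_mul_eq_mul_div, ← add_div, eq_div_iff hdet]
      ring

theorem IsZeroSumAtom.exists_ne {U : Finset ι} (hU : IsZeroSumAtom f U)
    (h0 : ∀ i ∈ U, f i ≠ 0) (hp : ¬ p ∣ U.card) : ∃ i ∈ U, ∃ j ∈ U, f i ≠ f j := by
  by_contra! h
  obtain ⟨i, hi⟩ := hU.1
  have hs : U.card • f i = 0 := by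
    rw [← hU.2.1, ← Finset.sum_const]
    exact Finset.sum_congr rfl fun j hj => h i hi j hj
  rw [← Nat.cast_smul_eq_nsmul (ZMod p), smul_eq_zero] at hs
  rcases hs with hs | hs
  · exact hp ((ZMod.natCast_eq_zero_iff _ _).1 hs)
  · exact h0 i hi hs

theorem IsZeroSumAtom.two_le_card {G : Type*} [AddCommGroup G] {f : ι → G} {U : Finset ι}
    (hU : IsZeroSumAtom f U) (h0 : ∀ i ∈ U, f i ≠ 0) : 2 ≤ U.card := by
  by_contra h
  have h1 : U.card = 1 := by
    have := hU.1.card_pos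
    omega
  obtain ⟨i, rfl⟩ := Finset.card_eq_one.1 h1
  exact h0 i (Finset.mem_singleton_self i) (by simpa using hU.2.1)

variable [Fintype ι] [DecidableEq ι]

/-- Two odd atoms whose lengths are prime to `p` jointly have full depth. Either one of them has
two different parallel terms, or the terms `f i ≠ f j` of the second one form a basis and some
coordinate sum `α + β` of a term of the first one does not vanish: if all of them vanished, the
first atom would lie on the line through `f i - f j`. -/
theorem HasDepth.union_odd_atoms (hp2 : p ≠ 2) (hf : IsFactorial f) {U₁ U₂ : Finset ι}
    (hU₁ : IsZeroSumAtom f U₁) (hU₂ : IsZeroSumAtom f U₂) (hd : Disjoint U₁ U₂)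
    (hodd₁ : Odd U₁.card) (hodd₂ : Odd U₂.card) (h₁ : ∀ i ∈ U₁, f i ≠ 0)
    (h₂ : ∀ i ∈ U₂, f i ≠ 0) (hp₁ : ¬ p ∣ U₁.card) (hp₂ : ¬ p ∣ U₂.card) :
    HasDepth p f (U₁ ∪ U₂) (U₁.card + U₂.card) := by
  have hc₁ := hU₁.1.card_pos
  have hc₂ := hU₂.1.card_pos
  have hsum : ∑ i ∈ U₁ ∪ U₂, f i = 0 := by
    rw [Finset.sum_union hd, hU₁.2.1, hU₂.2.1, add_zero]
  have hodd : Odd (U₁.card + U₂.card - 1) := by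
    rw [Nat.odd_iff] at *
    omega
  suffices h : HasDepth p f (U₁ ∪ U₂) (U₁.card + U₂.card - 1) by
    have := h.succ_of_odd hp2 hsum hodd
    rwa [Nat.sub_add_cancel (by omega)] at this
  obtain ⟨i, hi, j, hj, hij⟩ := hU₂.exists_ne h₂ hp₂
  have hij' : i ≠ j := fun h => hij (congrArg f h)
  rcases exists_smul_or_forall_exists_smul_add_smul (h₂ i hi) (f j) with ⟨t, ht⟩ | hspan
  · have ht1 : (1 : ZMod p) ≠ t := by
      rintro rfl
      exact hij (by rw [ht, one_smul])
    have h := (HasDepth.of_atom (p := p) hU₁).union hf hd hU₁.2.1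
      (HasDepth.of_atom_of_smul hU₂ hi hj hij' (one_smul _ _).symm ht ht1)
    exact h.mono_right (by omega)
  · by_cases hk : ∃ k ∈ U₁, ∃ α β : ZMod p, f k = α • f i + β • f j ∧ α + β ≠ 0
    · obtain ⟨k, hk, α, β, hfk, hαβ⟩ := hk
      exact HasDepth.union_atoms_of_smul_add_smul hf hU₁ hU₂ hd hodd₁ hi hj hij' hk hfk hαβ
    · push Not at hk
      have hline : ∀ k ∈ U₁, ∃ α : ZMod p, f k = α • (f i - f j) := by
        intro k hkU
        obtain ⟨α, β, hαβ⟩ := hspan (f k)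
        refine ⟨α, ?_⟩
        have hβ : β = -α := (neg_eq_of_add_eq_zero_right (hk k hkU α β hαβ)).symm
        rw [hαβ, hβ, smul_sub, neg_smul, sub_eq_add_neg]
      obtain ⟨k, hk, l, hl, hkl⟩ := hU₁.exists_ne h₁ hp₁
      obtain ⟨a, ha⟩ := hline k hk
      obtain ⟨b, hb⟩ := hline l hl
      have hab : a ≠ b := by
        rintro rfl
        exact hkl (ha.trans hb.symm)
      have hkl' : k ≠ l := fun h => hkl (congrArg f h)
      have h := (HasDepth.of_atom_of_smul hU₁ hk hl hkl' ha hb hab).union hf hd hU₁.2.1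
        (HasDepth.of_atom (p := p) hU₂)
      exact h.mono_right (by omega)

/-- If no atom has length divisible by the odd prime `p`, the depth falls short of the number of
terms by at most one, and it does not fall short for an even number of terms. -/
theorem exists_hasDepth_of_not_dvd (hp2 : p ≠ 2) (hf : IsFactorial f) (Z : Finset ι)
    (hZ : ∑ i ∈ Z, f i = 0) (h0 : ∀ i ∈ Z, f i ≠ 0)
    (hp : ∀ U ⊆ Z, IsZeroSumAtom f U → ¬ p ∣ U.card) :
    ∃ m, HasDepth p f Z m ∧ Z.card ≤ m + 1 ∧ (Even Z.card → Z.card ≤ m) := by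
  induction Z using Finset.strongInduction with
  | H Z ih =>
    rcases Z.eq_empty_or_nonempty with rfl | hne
    · exact ⟨0, HasDepth.empty, by simp, by simp⟩
    -- splitting off a zero-sum subfamily of even size and full depth
    have hstep : ∀ W ⊆ Z, W.Nonempty → ∑ i ∈ W, f i = 0 → Even W.card →
        HasDepth p f W W.card →
        ∃ m, HasDepth p f Z m ∧ Z.card ≤ m + 1 ∧ (Even Z.card → Z.card ≤ m) := by
      intro W hW hWne hW0 hWeven hWd
      obtain ⟨m, hm, hm1, hm2⟩ := ih (Z \ W) (Finset.sdiff_ssubset hW hWne)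
        (hf.sum_sdiff hZ hW0) (fun i hi => h0 i (Finset.sdiff_subset hi))
        (fun U hU => hp U (hU.trans Finset.sdiff_subset))
      have hc := Finset.card_sdiff_add_card_eq_card hW
      refine ⟨W.card + m, ?_, by omega, fun hev => ?_⟩
      · have := hWd.union hf Finset.disjoint_sdiff hW0 hm
        rwa [Finset.union_sdiff_of_subset hW] at this
      · have : Even (Z \ W).card := by
          rw [Nat.even_iff] at *
          omega
        have := hm2 this
        omega
    by_cases hev : ∃ U ⊆ Z, IsZeroSumAtom f U ∧ Even U.card
    · obtain ⟨U, hUZ, hU, hUev⟩ := hev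
      have hodd : Odd (U.card - 1) := by
        have := hU.1.card_pos
        rw [Nat.even_iff] at hUev
        rw [Nat.odd_iff]
        omega
      refine hstep U hUZ hU.1 hU.2.1 hUev ?_
      have := (HasDepth.of_atom (p := p) hU).succ_of_odd hp2 hU.2.1 hodd
      rwa [Nat.sub_add_cancel hU.1.card_pos] at this
    · push Not at hev
      obtain ⟨U₁, hU₁Z, hU₁⟩ := exists_isZeroSumAtom hZ hne
      have hodd₁ := Nat.not_even_iff_odd.1 (hev U₁ hU₁Z hU₁)
      rcases (Z \ U₁).eq_empty_or_nonempty with hemp | hne'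
      · have hZU : Z = U₁ := (Finset.sdiff_eq_empty_iff_subset.1 hemp).antisymm hU₁Z
        rw [hZU]
        refine ⟨U₁.card - 1, HasDepth.of_atom hU₁, by omega, fun h => ?_⟩
        exact absurd h (Nat.not_even_iff_odd.2 hodd₁)
      · obtain ⟨U₂, hU₂Z, hU₂⟩ := exists_isZeroSumAtom (hf.sum_sdiff hZ hU₁.2.1) hne'
        have hU₂Z' := hU₂Z.trans Finset.sdiff_subset
        have hodd₂ := Nat.not_even_iff_odd.1 (hev U₂ hU₂Z' hU₂)
        have hd : Disjoint U₁ U₂ := (Finset.subset_sdiff.1 hU₂Z).2.symm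
        have h := HasDepth.union_odd_atoms hp2 hf hU₁ hU₂ hd hodd₁ hodd₂
          (fun i hi => h0 i (hU₁Z hi)) (fun i hi => h0 i (hU₂Z' hi)) (hp _ hU₁Z hU₁)
          (hp _ hU₂Z' hU₂)
        refine hstep (U₁ ∪ U₂) (Finset.union_subset hU₁Z hU₂Z')
          (hU₁.1.mono Finset.subset_union_left) ?_ ?_ ?_
        · rw [Finset.sum_union hd, hU₁.2.1, hU₂.2.1, add_zero]
        · rw [Finset.card_union_of_disjoint hd]
          exact hodd₁.add_odd hodd₂
        · rwa [Finset.card_union_of_disjoint hd]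

theorem exists_hasDepth (hf : IsFactorial f) (Z : Finset ι) (hZ : ∑ i ∈ Z, f i = 0)
    (h0 : ∀ i ∈ Z, f i ≠ 0) : ∃ m, HasDepth p f Z m ∧ Z.card ≤ 2 * m := by
  induction Z using Finset.strongInduction with
  | H Z ih =>
    rcases Z.eq_empty_or_nonempty with rfl | hne
    · exact ⟨0, HasDepth.empty, by simp⟩
    obtain ⟨U, hUZ, hU⟩ := exists_isZeroSumAtom hZ hne
    obtain ⟨m, hm, hm1⟩ := ih (Z \ U) (Finset.sdiff_ssubset hUZ hU.1) (hf.sum_sdiff hZ hU.2.1)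
      (fun i hi => h0 i (Finset.sdiff_subset hi))
    have hc := Finset.card_sdiff_add_card_eq_card hUZ
    have h2 := hU.two_le_card fun i hi => h0 i (hUZ hi)
    refine ⟨U.card - 1 + m, ?_, by omega⟩
    have := (HasDepth.of_atom (p := p) hU).union hf Finset.disjoint_sdiff hU.2.1 hm
    rwa [Finset.union_sdiff_of_subset hUZ] at this

/-- A factorial family over an elementary `p`-group of rank two has at most `2 * p` nonzero
terms. -/
theorem IsFactorial.card_ne_zero_le_two_mul (hf : IsFactorial f) :
    (Finset.univ.filter fun i => f i ≠ 0).card ≤ 2 * p := by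
  set Z := Finset.univ.filter fun i => f i ≠ 0 with hZdef
  have hp2le : 2 ≤ p := (Fact.out : p.Prime).two_le
  have hZ : ∑ i ∈ Z, f i = 0 := by
    rw [hZdef, Finset.sum_filter_ne_zero]
    exact hf.1
  have h0 : ∀ i ∈ Z, f i ≠ 0 := fun i hi => (Finset.mem_filter.1 hi).2
  -- for `p = 2` an atom of length `l ≥ 2` has depth at least `l / 2`, and depths are at most `2`
  by_cases hp2 : p = 2
  · obtain ⟨m, hm, hm'⟩ := exists_hasDepth hf Z hZ h0
    have := hm.lt
    omega
  by_cases hex : ∃ U ⊆ Z, IsZeroSumAtom f U ∧ p ∣ U.card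
  · obtain ⟨U, hUZ, hU, hpU⟩ := hex
    have hcU := Nat.le_of_dvd hU.1.card_pos hpU
    have hc := Finset.card_sdiff_add_card_eq_card hUZ
    have hZU := hf.sum_sdiff hZ hU.2.1
    have h0' : ∀ i ∈ Z \ U, f i ≠ 0 := fun i hi => h0 i (Finset.sdiff_subset hi)
    by_cases hex' : ∃ V ⊆ Z \ U, IsZeroSumAtom f V ∧ p ∣ V.card
    -- the two exceptional atoms use up the whole depth
    · obtain ⟨V, hVZ, hV, hpV⟩ := hex'
      have hcV := Nat.le_of_dvd hV.1.card_pos hpV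
      have hc' := Finset.card_sdiff_add_card_eq_card hVZ
      obtain ⟨m, hm, hm'⟩ := exists_hasDepth hf ((Z \ U) \ V) (hf.sum_sdiff hZU hV.2.1)
        (fun i hi => h0' i (Finset.sdiff_subset hi))
      have h1 := (HasDepth.of_atom (p := p) hV).union hf Finset.disjoint_sdiff hV.2.1 hm
      rw [Finset.union_sdiff_of_subset hVZ] at h1
      have h2 := ((HasDepth.of_atom (p := p) hU).union hf Finset.disjoint_sdiff hU.2.1 h1).lt
      omega
    · push Not at hex'
      obtain ⟨m, hm, hm1, -⟩ := exists_hasDepth_of_not_dvd hp2 hf (Z \ U) hZU h0' hex'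
      have h2 := ((HasDepth.of_atom (p := p) hU).union hf Finset.disjoint_sdiff hU.2.1 hm).lt
      omega
  · push Not at hex
    obtain ⟨m, hm, hm1, -⟩ := exists_hasDepth_of_not_dvd hp2 hf Z hZ h0 hex
    have := hm.lt
    omega

/-- A factorial family over a group of prime order `p` has at most `p` nonzero terms: two copies
of it, one in each coordinate, form a factorial family over the elementary group of rank two. -/
theorem IsFactorial.card_ne_zero_le {g : ι → ZMod p} (hg : IsFactorial g) :
    (Finset.univ.filter fun i => g i ≠ 0).card ≤ p := by
  let f : ι ⊕ ι → ZMod p × ZMod p := Sum.elim (fun i => (g i, 0)) (fun i => (0, g i))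
  have hsum : ∀ A : Finset (ι ⊕ ι), ∑ i ∈ A, f i = (∑ i ∈ A.toLeft, g i, ∑ i ∈ A.toRight, g i) := by
    intro A
    conv_lhs => rw [← Finset.toLeft_disjSum_toRight (u := A)]
    rw [Finset.sum_disjSum]
    ext <;> simp [f, Prod.fst_sum, Prod.snd_sum]
  have hf : IsFactorial f := by
    refine ⟨?_, fun A B hA hB => ?_⟩
    · rw [hsum]
      simp [hg.1]
    · rw [hsum, Prod.mk_eq_zero] at hA hB ⊢
      rw [Finset.toLeft_inter, Finset.toRight_inter]
      exact ⟨hg.2 _ _ hA.1 hB.1, hg.2 _ _ hA.2 hB.2⟩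
  have h := hf.card_ne_zero_le_two_mul
  have hcard : (Finset.univ.filter fun i => f i ≠ 0).card =
      2 * (Finset.univ.filter fun i => g i ≠ 0).card := by
    rw [two_mul, ← Finset.card_disjSum]
    congr 1
    ext i
    rcases i with i | i <;> simp [f]
  omega

end ElementaryRankTwo

/-! ### Reduction to a subgroup of prime index -/

section Reduction

/-- The contribution of `g` to a cross number: the inverse of its order, and `0` for `g = 0`. -/
noncomputable def invOrder {G : Type*} [AddCommGroup G] (g : G) : ℝ :=
  open Classical in if g = 0 then 0 else 1 / (addOrderOf g : ℝ)

section InvOrder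

variable {G : Type*} [AddCommGroup G]

theorem invOrder_zero : invOrder (0 : G) = 0 := if_pos rfl

theorem invOrder_of_ne_zero {g : G} (hg : g ≠ 0) : invOrder g = 1 / (addOrderOf g : ℝ) := if_neg hg

theorem invOrder_nonneg (g : G) : 0 ≤ invOrder g := by
  unfold invOrder
  split_ifs
  · exact le_rfl
  · positivity

theorem invOrder_map_of_injective {H : Type*} [AddCommGroup H] {θ : G →+ H}
    (hθ : Function.Injective θ) (g : G) : invOrder (θ g) = invOrder g := by
  by_cases hg : g = 0
  · rw [hg, map_zero, invOrder_zero, invOrder_zero]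
  · rw [invOrder_of_ne_zero hg, invOrder_of_ne_zero ((map_ne_zero_iff θ hθ).2 hg),
      addOrderOf_injective θ hθ]

theorem le_invOrder {g : G} (hg : g ≠ 0) {n : ℕ} (hn : 0 < n) (h : n • g = 0) :
    1 / (n : ℝ) ≤ invOrder g := by
  have hd := addOrderOf_dvd_of_nsmul_eq_zero h
  have hpos := Nat.pos_of_dvd_of_pos hd hn
  rw [invOrder_of_ne_zero hg]
  exact one_div_le_one_div_of_le (by exact_mod_cast hpos) (by exact_mod_cast Nat.le_of_dvd hn hd)

end InvOrder

variable {ι G : Type*} [Fintype ι] [DecidableEq ι] [AddCommGroup G] {ℓ : ℕ} [Fact ℓ.Prime]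
  {π : G →+ ZMod ℓ} {f : ι → G}

/-- If the subsums in `T` that vanish under `π` are zero, then the image of the factorial family
obtained by merging all terms outside `T` is factorial, so `T` has at most `ℓ` terms. -/
theorem IsFactorial.card_le_of_forall_map_sum (hf : IsFactorial f) {T : Finset ι}
    (hT : ∀ i ∈ T, π (f i) ≠ 0)
    (h : ∀ V ⊆ T, π (∑ i ∈ V, f i) = 0 → ∑ i ∈ V, f i = 0) : T.card ≤ ℓ := by
  have key : ∀ g : ι → G, IsFactorial g → (∀ i ∈ T, g i = f i) →
      (∀ A : Finset ι, π (∑ i ∈ A, g i) = 0 → ∑ i ∈ A, g i = 0) → T.card ≤ ℓ := by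
    intro g hg hgf hπ
    have hfac : IsFactorial fun i => π (g i) := by
      simp only [IsFactorial, ← map_sum]
      exact ⟨by rw [hg.1, map_zero], fun A B hA hB => by
        rw [hg.2 A B (hπ A hA) (hπ B hB), map_zero]⟩
    refine (Finset.card_le_card fun i hi => ?_).trans hfac.card_ne_zero_le
    rw [Finset.mem_filter, hgf i hi]
    exact ⟨Finset.mem_univ i, hT i hi⟩
  rcases Tᶜ.eq_empty_or_nonempty with hemp | ⟨w, hw⟩
  · refine key f hf (fun _ _ => rfl) fun A hA => h A ?_ hA
    rw [(Finset.compl_eq_empty_iff T).1 hemp]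
    exact Finset.subset_univ A
  · refine key (CrossNumber.merge f Tᶜ w) (hf.merge hw)
      (fun i hi => merge_of_notMem f hw (by simpa using hi)) fun A hA => ?_
    rw [sum_merge f hw] at hA ⊢
    split_ifs at hA ⊢
    · have hsum := Finset.sum_add_sum_compl (A ∪ Tᶜ) f
      rw [hf.1] at hsum
      have hc : ∑ i ∈ (A ∪ Tᶜ)ᶜ, f i = 0 := by
        refine h _ (fun i hi => ?_) ?_
        · simp only [Finset.mem_compl, Finset.mem_union, not_or, not_not] at hi
          exact hi.2
        · have := congrArg π hsum
          rwa [map_add, hA, zero_add, map_zero] at this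
      rwa [hc, add_zero] at hsum
    · refine h _ (fun i hi => ?_) hA
      simpa using (Finset.mem_sdiff.1 hi).2

/-- A subfamily of minimal size among those with nonzero sum in `ker π` is minimal zero-sum modulo
`ker π`, hence has at most `ℓ` terms. -/
theorem exists_card_le_of_map_sum_eq_zero {T : Finset ι} (hT : ∀ i ∈ T, π (f i) ≠ 0)
    (h : ∃ V ⊆ T, π (∑ i ∈ V, f i) = 0 ∧ ∑ i ∈ V, f i ≠ 0) :
    ∃ W ⊆ T, π (∑ i ∈ W, f i) = 0 ∧ ∑ i ∈ W, f i ≠ 0 ∧ W.card ≤ ℓ := by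
  classical
  have hne : (T.powerset.filter fun V => π (∑ i ∈ V, f i) = 0 ∧ ∑ i ∈ V, f i ≠ 0).Nonempty := by
    obtain ⟨V, hV, hV'⟩ := h
    exact ⟨V, Finset.mem_filter.2 ⟨Finset.mem_powerset.2 hV, hV'⟩⟩
  obtain ⟨W, hW, hmin⟩ := Finset.exists_min_image _ Finset.card hne
  simp only [Finset.mem_filter, Finset.mem_powerset] at hW hmin
  obtain ⟨hWT, hW0, hWne⟩ := hW
  refine ⟨W, hWT, hW0, hWne, ?_⟩
  let g : ι → ZMod ℓ := fun i => if i ∈ W then π (f i) else 0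
  have hg : ∀ V ⊆ W, ∑ i ∈ V, g i = π (∑ i ∈ V, f i) := by
    intro V hV
    rw [map_sum]
    exact Finset.sum_congr rfl fun i hi => if_pos (hV hi)
  have hfac : IsFactorial g := by
    refine isFactorial_of_minimal (W := W) (fun i hi => if_neg hi) ((hg W subset_rfl).trans hW0) ?_
    intro V hV hV0
    rw [hg V hV] at hV0
    by_contra hcon
    push Not at hcon
    obtain ⟨hV1, hV2⟩ := hcon
    have hlt := Finset.card_lt_card (hV.ssubset_of_ne hV2)
    have hVz : ∑ i ∈ V, f i = 0 := by
      by_contra hVz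
      have := hmin V ⟨hV.trans hWT, hV0, hVz⟩
      omega
    have hs : ∑ i ∈ W \ V, f i = ∑ i ∈ W, f i := by
      rw [← Finset.sum_sdiff hV, hVz, add_zero]
    have := hmin (W \ V) ⟨Finset.sdiff_subset.trans hWT, by rw [hs, hW0], by rwa [hs]⟩
    have hc := Finset.card_sdiff_add_card_eq_card hV
    have := hV1.card_pos
    omega
  refine (Finset.card_le_card fun i hi => ?_).trans hfac.card_ne_zero_le
  simp only [Finset.mem_filter, Finset.mem_univ, true_and, g, if_pos hi]
  exact hT i (hWT hi)

/-- Outside the kernel of `π`, the subgroup of elements killed by `ℓ ^ a * r ^ b`, the order is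
`ℓ ^ (a + 1)` times a power of `r`. -/
theorem exists_addOrderOf_eq {r a b : ℕ} (hr : r.Prime)
    (hexp : ∀ g : G, (ℓ ^ (a + 1) * r ^ b) • g = 0)
    (hker : ∀ g : G, π g = 0 ↔ (ℓ ^ a * r ^ b) • g = 0) {g : G} (hg : π g ≠ 0) :
    ∃ k ≤ b, addOrderOf g = ℓ ^ (a + 1) * r ^ k := by
  obtain ⟨d, e, hd, he, hde⟩ := (Nat.dvd_mul).1 (addOrderOf_dvd_of_nsmul_eq_zero (hexp g))
  obtain ⟨i, hi, rfl⟩ := (Nat.dvd_prime_pow Fact.out).1 hd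
  obtain ⟨k, hk, rfl⟩ := (Nat.dvd_prime_pow hr).1 he
  refine ⟨k, hk, ?_⟩
  rcases hi.lt_or_eq with hi | hi
  · exfalso
    apply hg
    rw [hker]
    apply addOrderOf_dvd_iff_nsmul_eq_zero.1
    rw [← hde]
    exact mul_dvd_mul (pow_dvd_pow ℓ (by omega)) (pow_dvd_pow r hk)
  · rw [← hde, hi]

/-- The weight of `g` in the induction that proves `IsFactorial.sum_invOrder_le_of_reduction`:
outside the kernel of `π`, the inverse order is capped at `c`. -/
noncomputable def cappedInvOrder (π : G →+ ZMod ℓ) (c : ℝ) (g : G) : ℝ :=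
  if π g = 0 then invOrder g else min (invOrder g) c

theorem cappedInvOrder_of_map_eq_zero {c : ℝ} {g : G} (hg : π g = 0) :
    cappedInvOrder π c g = invOrder g := if_pos hg

theorem cappedInvOrder_of_map_ne_zero {c : ℝ} {g : G} (hg : π g ≠ 0) :
    cappedInvOrder π c g = min (invOrder g) c := if_neg hg

theorem cappedInvOrder_le {c : ℝ} {g : G} (hg : π g ≠ 0) : cappedInvOrder π c g ≤ c := by
  rw [cappedInvOrder_of_map_ne_zero hg]
  exact min_le_right _ _

/-- Merging `W` into one term of `ker π` changes the capped cross number by at most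
`|W| * c - invOrder (∑ i ∈ W, f i)`. -/
theorem sum_cappedInvOrder_le_merge {c : ℝ} {W : Finset ι} {w : ι} (hw : w ∈ W)
    (hW : ∀ i ∈ W, π (f i) ≠ 0) (hW0 : π (∑ i ∈ W, f i) = 0) :
    ∑ i, cappedInvOrder π c (f i) + invOrder (∑ i ∈ W, f i) ≤
      ∑ i, cappedInvOrder π c (merge f W w i) + W.card * c := by
  have h1 : ∑ i ∈ W, cappedInvOrder π c (f i) ≤ W.card * c := by
    rw [← nsmul_eq_mul]
    exact Finset.sum_le_card_nsmul _ _ _ fun i hi => cappedInvOrder_le (hW i hi)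
  have h2 : ∑ i ∈ Wᶜ, cappedInvOrder π c (merge f W w i) =
      ∑ i ∈ Wᶜ, cappedInvOrder π c (f i) :=
    Finset.sum_congr rfl fun i hi => by rw [merge_of_notMem f hw (Finset.mem_compl.1 hi)]
  have h3 : ∑ i ∈ W, cappedInvOrder π c (merge f W w i) = invOrder (∑ i ∈ W, f i) := by
    rw [Finset.sum_eq_single_of_mem w hw fun i hi hne => ?_, merge_self,
      cappedInvOrder_of_map_eq_zero hW0]
    rw [merge_of_mem f hi hne, cappedInvOrder_of_map_eq_zero (map_zero π), invOrder_zero]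
  rw [← Finset.sum_add_sum_compl W, ← Finset.sum_add_sum_compl W, h2, h3]
  linarith

/-- The terms outside `ker π` are merged in groups of at most `ℓ` terms with nonzero sum in
`ker π`, with preference for groups whose orders have a small `r`-part `r ^ j`. A group of terms
with `r`-parts at most `r ^ j` gets a sum of order at most `ℓ ^ a * r ^ j`, which pays for `ℓ` terms
of order `ℓ ^ (a + 1) * r ^ j`. Capping the inverse orders at `1 / (ℓ ^ (a + 1) * r ^ j)` makes this
exact; when no further group exists at level `j`, at most `ℓ` terms are affected by lowering
the cap to the next level. -/
theorem IsFactorial.sum_cappedInvOrder_le {r a b : ℕ} (hr : r.Prime) (hℓr : ℓ ≠ r)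
    (hexp : ∀ g : G, (ℓ ^ (a + 1) * r ^ b) • g = 0)
    (hker : ∀ g : G, π g = 0 ↔ (ℓ ^ a * r ^ b) • g = 0) {K : ℝ}
    (hK : ∀ g : ι → G, IsFactorial g → (∀ i, π (g i) = 0) → ∑ i, invOrder (g i) ≤ K)
    (hf : IsFactorial f) {j : ℕ} (hj : j ≤ b) :
    ∑ i, cappedInvOrder π (1 / (ℓ ^ (a + 1) * r ^ j)) (f i) ≤ K + 1 / (ℓ ^ a * r ^ j) := by
  classical
  have hℓ : ℓ.Prime := Fact.out
  have hℓ0 : (0 : ℝ) < ℓ := by exact_mod_cast hℓ.pos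
  have hr0 : (0 : ℝ) < r := by exact_mod_cast hr.pos
  have hℓc : ∀ j : ℕ, (ℓ : ℝ) * (1 / (ℓ ^ (a + 1) * r ^ j)) = 1 / (ℓ ^ a * r ^ j) := by
    intro j
    rw [pow_succ]
    field_simp
  obtain ⟨n, hn⟩ : ∃ n, (Finset.univ.filter fun i => π (f i) ≠ 0).card + (b - j) = n := ⟨_, rfl⟩
  induction n using Nat.strong_induction_on generalizing f j with
  | _ n ih =>
    set c : ℝ := 1 / (ℓ ^ (a + 1) * r ^ j) with hc
    have hc0 : 0 < c := by positivity
    set T := Finset.univ.filter fun i => π (f i) ≠ 0 ∧ (ℓ ^ (a + 1) * r ^ j) • f i = 0 with hTdef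
    have hT : ∀ i ∈ T, π (f i) ≠ 0 := fun i hi => (Finset.mem_filter.1 hi).2.1
    by_cases hgood : ∃ V ⊆ T, π (∑ i ∈ V, f i) = 0 ∧ ∑ i ∈ V, f i ≠ 0
    · obtain ⟨W, hWT, hW0, hWne, hWc⟩ := exists_card_le_of_map_sum_eq_zero hT hgood
      obtain ⟨w, hw⟩ : W.Nonempty := by
        rw [Finset.nonempty_iff_ne_empty]
        rintro rfl
        exact hWne Finset.sum_empty
      have hWπ : ∀ i ∈ W, π (f i) ≠ 0 := fun i hi => hT i (hWT hi)
      have hmerge := sum_cappedInvOrder_le_merge (c := c) hw hWπ hW0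
      have hkill : (ℓ ^ a * r ^ j) • ∑ i ∈ W, f i = 0 := by
        have h1 : (ℓ ^ (a + 1) * r ^ j) • ∑ i ∈ W, f i = 0 := by
          rw [Finset.smul_sum]
          exact Finset.sum_eq_zero fun i hi => (Finset.mem_filter.1 (hWT hi)).2.2
        have h2 := (hker _).1 hW0
        have hcop : Nat.Coprime ℓ (r ^ (b - j)) :=
          Nat.Coprime.pow_right _ ((Nat.coprime_primes hℓ hr).2 hℓr)
        have hg : Nat.gcd (ℓ ^ (a + 1) * r ^ j) (ℓ ^ a * r ^ b) = ℓ ^ a * r ^ j := by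
          have e1 : ℓ ^ (a + 1) * r ^ j = (ℓ ^ a * r ^ j) * ℓ := by ring
          have e2 : ℓ ^ a * r ^ b = (ℓ ^ a * r ^ j) * r ^ (b - j) := by
            rw [mul_assoc, ← pow_add, Nat.add_sub_cancel' hj]
          rw [e1, e2, Nat.gcd_mul_left, hcop, mul_one]
        rw [← hg]
        exact addOrderOf_dvd_iff_nsmul_eq_zero.1 (Nat.dvd_gcd
          (addOrderOf_dvd_of_nsmul_eq_zero h1) (addOrderOf_dvd_of_nsmul_eq_zero h2))
      have hge := le_invOrder hWne (Nat.mul_pos (pow_pos hℓ.pos a) (pow_pos hr.pos j)) hkill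
      push_cast at hge
      rw [← hℓc, ← hc] at hge
      have hWc' : (W.card : ℝ) * c ≤ ℓ * c :=
        mul_le_mul_of_nonneg_right (by exact_mod_cast hWc) hc0.le
      have hlt : (Finset.univ.filter fun i => π (CrossNumber.merge f W w i) ≠ 0).card <
          (Finset.univ.filter fun i => π (f i) ≠ 0).card := by
        refine Finset.card_lt_card ⟨fun i hi => ?_, fun h => ?_⟩
        · by_cases hiW : i ∈ W
          · exact Finset.mem_filter.2 ⟨Finset.mem_univ i, hWπ i hiW⟩
          · simpa [merge_of_notMem f hw hiW] using hi
        · have := (Finset.mem_filter.1 (h (Finset.mem_filter.2 ⟨Finset.mem_univ w, hWπ w hw⟩))).2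
          rw [merge_self] at this
          exact this hW0
      have := ih _ (by omega) (hf.merge hw) hj rfl
      linarith
    · push Not at hgood
      have hTc : T.card ≤ ℓ := hf.card_le_of_forall_map_sum hT hgood
      rcases hj.lt_or_eq with hjb | hjb
      -- the cap is lowered to the next level
      · set c' : ℝ := 1 / (ℓ ^ (a + 1) * r ^ (j + 1)) with hc'
        have hcc' : c' ≤ c := by
          rw [hc, hc']
          refine one_div_le_one_div_of_le (by positivity) ?_
          refine mul_le_mul_of_nonneg_left ?_ (by positivity)
          exact pow_le_pow_right₀ (by exact_mod_cast hr.one_lt.le) (Nat.le_succ j)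
        have hterm : ∀ i, cappedInvOrder π c (f i) ≤
            cappedInvOrder π c' (f i) + if i ∈ T then c - c' else 0 := by
          intro i
          by_cases hi : π (f i) = 0
          · rw [cappedInvOrder_of_map_eq_zero hi, cappedInvOrder_of_map_eq_zero hi]
            split_ifs <;> linarith
          · rw [cappedInvOrder_of_map_ne_zero hi, cappedInvOrder_of_map_ne_zero hi]
            have hne : f i ≠ 0 := fun h => hi (by rw [h, map_zero])
            split_ifs with hiT
            · have hge := le_invOrder hne (Nat.mul_pos (pow_pos hℓ.pos (a + 1)) (pow_pos hr.pos j))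
                (Finset.mem_filter.1 hiT).2.2
              push_cast at hge
              rw [← hc] at hge
              rw [min_eq_right hge, min_eq_right (hcc'.trans hge)]
              linarith
            · obtain ⟨k, hk, hord⟩ := exists_addOrderOf_eq hr hexp hker hi
              have hjk : j + 1 ≤ k := by
                by_contra hjk
                apply hiT
                refine Finset.mem_filter.2 ⟨Finset.mem_univ i, hi, ?_⟩
                apply addOrderOf_dvd_iff_nsmul_eq_zero.1
                rw [hord]
                exact mul_dvd_mul_left _ (pow_dvd_pow r (by omega))
              have hle : invOrder (f i) ≤ c' := by
                rw [invOrder_of_ne_zero hne, hord, hc']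
                push_cast
                refine one_div_le_one_div_of_le (by positivity) ?_
                refine mul_le_mul_of_nonneg_left ?_ (by positivity)
                exact pow_le_pow_right₀ (by exact_mod_cast hr.one_lt.le) hjk
              rw [min_eq_left hle, min_eq_left (hle.trans hcc'), add_zero]
        have hsum := Finset.sum_le_sum fun i (_ : i ∈ Finset.univ) => hterm i
        rw [Finset.sum_add_distrib, Finset.sum_ite_mem, Finset.univ_inter, Finset.sum_const,
          nsmul_eq_mul] at hsum
        have hnext := ih _ (by omega) hf (j := j + 1) hjb rfl
        have hTc' : (T.card : ℝ) * (c - c') ≤ ℓ * (c - c') :=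
          mul_le_mul_of_nonneg_right (by exact_mod_cast hTc) (by linarith)
        rw [← hℓc, ← hc'] at hnext
        rw [← hℓc, ← hc]
        linarith
      -- the remaining terms are merged into a single one
      · subst hjb
        have hTall : ∀ i, i ∉ T → π (f i) = 0 := by
          intro i hi
          by_contra h
          exact hi (Finset.mem_filter.2 ⟨Finset.mem_univ i, h, hexp _⟩)
        rcases T.eq_empty_or_nonempty with hemp | ⟨w, hw⟩
        · have hall : ∀ i, π (f i) = 0 := fun i =>
            hTall i (by rw [hemp]; exact Finset.notMem_empty i)
          have := hK f hf hall
          have h0 : (0 : ℝ) ≤ 1 / (ℓ ^ a * r ^ j) := by positivity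
          simp only [cappedInvOrder_of_map_eq_zero (hall _)]
          linarith
        · have hT0 : π (∑ i ∈ T, f i) = 0 := by
            have := congrArg π (Finset.sum_add_sum_compl T f)
            rw [hf.1, map_add, map_zero, map_sum π f Tᶜ,
              Finset.sum_eq_zero fun i hi => hTall i (Finset.mem_compl.1 hi), add_zero] at this
            exact this
          have hmerge := sum_cappedInvOrder_le_merge (c := c) hw hT hT0
          have hall : ∀ i, π (CrossNumber.merge f T w i) = 0 := by
            intro i
            by_cases hiw : i = w
            · rw [hiw, merge_self, hT0]
            · by_cases hi : i ∈ T
              · rw [merge_of_mem f hi hiw, map_zero]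
              · rw [merge_of_notMem f hw hi, hTall i hi]
          have hb := hK _ (hf.merge hw) hall
          simp only [cappedInvOrder_of_map_eq_zero (hall _)] at hmerge
          have := invOrder_nonneg (∑ i ∈ T, f i)
          have hTc' : (T.card : ℝ) * c ≤ ℓ * c :=
            mul_le_mul_of_nonneg_right (by exact_mod_cast hTc) hc0.le
          rw [← hℓc, ← hc]
          linarith

/-- Passing to the subgroup of elements killed by `ℓ ^ a * r ^ b`, if it is the kernel of a
homomorphism to a group of order `ℓ`, costs at most `1 / ℓ ^ a` in the cross number. -/
theorem IsFactorial.sum_invOrder_le_of_reduction {r a b : ℕ} (hr : r.Prime) (hℓr : ℓ ≠ r)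
    (hexp : ∀ g : G, (ℓ ^ (a + 1) * r ^ b) • g = 0)
    (hker : ∀ g : G, π g = 0 ↔ (ℓ ^ a * r ^ b) • g = 0) {K : ℝ}
    (hK : ∀ g : ι → G, IsFactorial g → (∀ i, π (g i) = 0) → ∑ i, invOrder (g i) ≤ K)
    (hf : IsFactorial f) : ∑ i, invOrder (f i) ≤ K + 1 / ℓ ^ a := by
  have hℓ : ℓ.Prime := Fact.out
  have h := hf.sum_cappedInvOrder_le hr hℓr hexp hker hK (Nat.zero_le b)
  simp only [pow_zero, mul_one] at h
  refine le_trans (Finset.sum_le_sum fun i _ => ?_) h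
  by_cases hi : π (f i) = 0
  · rw [cappedInvOrder_of_map_eq_zero hi]
  · rw [cappedInvOrder_of_map_ne_zero hi]
    refine le_min le_rfl ?_
    obtain ⟨k, hk, hord⟩ := exists_addOrderOf_eq hr hexp hker hi
    have hne : f i ≠ 0 := fun h => hi (by rw [h, map_zero])
    rw [invOrder_of_ne_zero hne, hord]
    have h1 : (0 : ℝ) < ℓ ^ (a + 1) := pow_pos (by exact_mod_cast hℓ.pos) _
    have h2 : (1 : ℝ) ≤ r ^ k := one_le_pow₀ (by exact_mod_cast hr.one_lt.le)
    push_cast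
    exact one_div_le_one_div_of_le h1 (le_mul_of_one_le_right h1.le h2)

end Reduction

/-! ### The upper bound -/

section UpperBound

theorem exists_injective_hom_zmod_pow {p : ℕ} (hp : p.Prime) (a : ℕ) :
    ∃ μ : ZMod (p ^ a) →+ ZMod (p ^ (a + 1)), Function.Injective μ ∧
      ∀ y, ZMod.castHom (dvd_pow_self p a.succ_ne_zero) (ZMod p) y = 0 → ∃ x, μ x = y := by
  have : NeZero (p ^ (a + 1)) := ⟨pow_ne_zero _ hp.ne_zero⟩
  let φ : ℤ →+ ZMod (p ^ (a + 1)) := zmultiplesHom _ (p : ZMod (p ^ (a + 1)))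
  have hφ : ∀ m : ℤ, φ m = ((m * p : ℤ) : ZMod (p ^ (a + 1))) := by
    intro m
    simp [φ]
  have h0 : φ ((p ^ a : ℕ) : ℤ) = 0 := by
    rw [hφ, ZMod.intCast_zmod_eq_zero_iff_dvd]
    push_cast
    rw [pow_succ]
  refine ⟨ZMod.lift (p ^ a) ⟨φ, h0⟩, ?_, ?_⟩
  · rw [ZMod.lift_injective]
    intro m hm
    rw [hφ, ZMod.intCast_zmod_eq_zero_iff_dvd] at hm
    rw [ZMod.intCast_zmod_eq_zero_iff_dvd]
    push_cast at hm ⊢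
    rw [pow_succ] at hm
    exact Int.dvd_of_mul_dvd_mul_right (by exact_mod_cast hp.ne_zero) hm
  · intro y hy
    rw [← ZMod.natCast_zmod_val y, map_natCast, ZMod.natCast_eq_zero_iff] at hy
    obtain ⟨m, hm⟩ := hy
    refine ⟨((m : ℤ) : ZMod (p ^ a)), ?_⟩
    rw [ZMod.lift_coe, hφ, ← ZMod.natCast_zmod_val y, hm]
    push_cast
    ring

theorem castHom_eq_zero_iff_nsmul {p : ℕ} (hp : p.Prime) {a c : ℕ} (hc : p.Coprime c)
    (y : ZMod (p ^ (a + 1))) :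
    ZMod.castHom (dvd_pow_self p a.succ_ne_zero) (ZMod p) y = 0 ↔ (p ^ a * c) • y = 0 := by
  have : NeZero (p ^ (a + 1)) := ⟨pow_ne_zero _ hp.ne_zero⟩
  obtain ⟨n, rfl⟩ : ∃ n : ℕ, (n : ZMod (p ^ (a + 1))) = y := ⟨y.val, ZMod.natCast_zmod_val y⟩
  rw [map_natCast, ZMod.natCast_eq_zero_iff, nsmul_eq_mul,
    ← Nat.cast_mul, ZMod.natCast_eq_zero_iff, pow_succ, mul_assoc,
    Nat.mul_dvd_mul_iff_left (pow_pos hp.pos a), hc.dvd_mul_left]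

theorem nsmul_zmod_eq_zero {m n : ℕ} (h : m ∣ n) (x : ZMod m) : n • x = 0 := by
  rw [nsmul_eq_mul, (ZMod.natCast_eq_zero_iff n m).2 h, zero_mul]

variable {ι : Type*} [Fintype ι] [DecidableEq ι] {p q : ℕ}

theorem sum_invOrder_le_base (hp : p.Prime) {f : ι → ZMod p × ZMod (p ^ 1) × ZMod (q ^ 0)}
    (hf : IsFactorial f) : ∑ i, invOrder (f i) ≤ 2 := by
  have : Fact p.Prime := ⟨hp⟩
  have hsub : Subsingleton (ZMod (q ^ 0)) := by
    rw [pow_zero]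
    infer_instance
  let e : ZMod (p ^ 1) ≃+* ZMod p := ZMod.ringEquivCongr (pow_one p)
  let θ : ZMod p × ZMod (p ^ 1) × ZMod (q ^ 0) →+ ZMod p × ZMod p :=
    { toFun := fun g => (g.1, e g.2.1)
      map_zero' := by simp
      map_add' := fun x y => Prod.ext rfl (map_add e x.2.1 y.2.1) }
  have hθ : Function.Injective θ := by
    rintro ⟨x, y, z⟩ ⟨x', y', z'⟩ h
    simp only [θ, AddMonoidHom.coe_mk, ZeroHom.coe_mk, Prod.mk.injEq,
      EmbeddingLike.apply_eq_iff_eq] at h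
    rw [h.1, h.2, Subsingleton.elim z z']
  have hg : IsFactorial fun i => θ (f i) := (IsFactorial.comp_injective_iff hθ).2 hf
  have hcard := hg.card_ne_zero_le_two_mul
  have hp0 : (0 : ℝ) < p := by exact_mod_cast hp.pos
  calc ∑ i, invOrder (f i) = ∑ i, if θ (f i) ≠ 0 then 1 / (p : ℝ) else 0 := by
        refine Finset.sum_congr rfl fun i _ => ?_
        rw [← invOrder_map_of_injective hθ]
        split_ifs with h
        · rw [invOrder_of_ne_zero h, addOrderOf_eq_prime (p := p) (by ext <;> simp) h]
        · rw [not_not.1 h, invOrder_zero]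
    _ = (Finset.univ.filter fun i => θ (f i) ≠ 0).card * (1 / (p : ℝ)) := by
        rw [← Finset.sum_filter, Finset.sum_const, nsmul_eq_mul]
    _ ≤ (2 * p : ℕ) * (1 / (p : ℝ)) :=
        mul_le_mul_of_nonneg_right (by exact_mod_cast hcard) (by positivity)
    _ = 2 := by
        push_cast
        field_simp

theorem sum_invOrder_le_succ_left (hp : p.Prime) (hq : q.Prime) (hpq : p ≠ q) {a b : ℕ}
    (ha : 0 < a) {K : ℝ}
    (hK : ∀ f : ι → ZMod p × ZMod (p ^ a) × ZMod (q ^ b), IsFactorial f →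
      ∑ i, invOrder (f i) ≤ K)
    {f : ι → ZMod p × ZMod (p ^ (a + 1)) × ZMod (q ^ b)} (hf : IsFactorial f) :
    ∑ i, invOrder (f i) ≤ K + 1 / p ^ a := by
  have : Fact p.Prime := ⟨hp⟩
  have hcop : p.Coprime (q ^ b) := Nat.Coprime.pow_right _ ((Nat.coprime_primes hp hq).2 hpq)
  obtain ⟨μ, hμ, hμ'⟩ := exists_injective_hom_zmod_pow hp a
  let π : ZMod p × ZMod (p ^ (a + 1)) × ZMod (q ^ b) →+ ZMod p :=
    (ZMod.castHom (dvd_pow_self p a.succ_ne_zero) (ZMod p)).toAddMonoidHom.comp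
      ((AddMonoidHom.fst _ _).comp (AddMonoidHom.snd _ _))
  let θ : ZMod p × ZMod (p ^ a) × ZMod (q ^ b) →+ ZMod p × ZMod (p ^ (a + 1)) × ZMod (q ^ b) :=
    (AddMonoidHom.id _).prodMap (μ.prodMap (AddMonoidHom.id _))
  have hθ : Function.Injective θ :=
    Function.injective_id.prodMap (hμ.prodMap Function.injective_id)
  refine hf.sum_invOrder_le_of_reduction (π := π) hq hpq (b := b) ?_ ?_ ?_
  · rintro ⟨x, y, z⟩
    ext
    · exact nsmul_zmod_eq_zero (dvd_mul_of_dvd_left (dvd_pow_self p a.succ_ne_zero) _) x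
    · exact nsmul_zmod_eq_zero (dvd_mul_right _ _) y
    · exact nsmul_zmod_eq_zero (dvd_mul_left _ _) z
  · rintro ⟨x, y, z⟩
    have h1 := nsmul_zmod_eq_zero (dvd_mul_of_dvd_left (dvd_pow_self p ha.ne') (q ^ b)) x
    have h2 := nsmul_zmod_eq_zero (dvd_mul_left (q ^ b) (p ^ a)) z
    simp only [Prod.smul_mk, h1, h2, Prod.mk_eq_zero, true_and, and_true]
    exact castHom_eq_zero_iff_nsmul hp hcop y
  · intro g hg hg0
    have hex : ∀ i, ∃ x, θ x = g i := by
      intro i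
      obtain ⟨y, hy⟩ := hμ' (g i).2.1 (hg0 i)
      exact ⟨((g i).1, y, (g i).2.2), Prod.ext rfl (Prod.ext hy rfl)⟩
    choose g' hg' using hex
    obtain rfl : (fun i => θ (g' i)) = g := funext hg'
    simp only [invOrder_map_of_injective hθ]
    exact hK g' ((IsFactorial.comp_injective_iff hθ).1 hg)

theorem sum_invOrder_le_succ_right (hp : p.Prime) (hq : q.Prime) (hpq : p ≠ q) {a b : ℕ}
    (ha : 0 < a) {K : ℝ}
    (hK : ∀ f : ι → ZMod p × ZMod (p ^ a) × ZMod (q ^ b), IsFactorial f →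
      ∑ i, invOrder (f i) ≤ K)
    {f : ι → ZMod p × ZMod (p ^ a) × ZMod (q ^ (b + 1))} (hf : IsFactorial f) :
    ∑ i, invOrder (f i) ≤ K + 1 / q ^ b := by
  have : Fact q.Prime := ⟨hq⟩
  have hcop : q.Coprime (p ^ a) := Nat.Coprime.pow_right _ ((Nat.coprime_primes hq hp).2 hpq.symm)
  obtain ⟨μ, hμ, hμ'⟩ := exists_injective_hom_zmod_pow hq b
  let π : ZMod p × ZMod (p ^ a) × ZMod (q ^ (b + 1)) →+ ZMod q :=
    (ZMod.castHom (dvd_pow_self q b.succ_ne_zero) (ZMod q)).toAddMonoidHom.comp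
      ((AddMonoidHom.snd _ _).comp (AddMonoidHom.snd _ _))
  let θ : ZMod p × ZMod (p ^ a) × ZMod (q ^ b) →+ ZMod p × ZMod (p ^ a) × ZMod (q ^ (b + 1)) :=
    (AddMonoidHom.id _).prodMap ((AddMonoidHom.id _).prodMap μ)
  have hθ : Function.Injective θ :=
    Function.injective_id.prodMap (Function.injective_id.prodMap hμ)
  refine hf.sum_invOrder_le_of_reduction (π := π) hp hpq.symm (b := a) ?_ ?_ ?_
  · rintro ⟨x, y, z⟩
    ext
    · exact nsmul_zmod_eq_zero (dvd_mul_of_dvd_right (dvd_pow_self p ha.ne') _) x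
    · exact nsmul_zmod_eq_zero (dvd_mul_left _ _) y
    · exact nsmul_zmod_eq_zero (dvd_mul_right _ _) z
  · rintro ⟨x, y, z⟩
    have h1 := nsmul_zmod_eq_zero (dvd_mul_of_dvd_right (dvd_pow_self p ha.ne') (q ^ b)) x
    have h2 := nsmul_zmod_eq_zero (dvd_mul_left (p ^ a) (q ^ b)) y
    simp only [Prod.smul_mk, h1, h2, Prod.mk_eq_zero, true_and]
    exact castHom_eq_zero_iff_nsmul hq hcop z
  · intro g hg hg0
    have hex : ∀ i, ∃ x, θ x = g i := by
      intro i
      obtain ⟨z, hz⟩ := hμ' (g i).2.2 (hg0 i)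
      exact ⟨((g i).1, (g i).2.1, z), Prod.ext rfl (Prod.ext rfl hz)⟩
    choose g' hg' using hex
    obtain rfl : (fun i => θ (g' i)) = g := funext hg'
    simp only [invOrder_map_of_injective hθ]
    exact hK g' ((IsFactorial.comp_injective_iff hθ).1 hg)

theorem sum_invOrder_le (hp : p.Prime) (hq : q.Prime) (hpq : p ≠ q) {a : ℕ} (ha : 0 < a) (b : ℕ)
    (f : ι → ZMod p × ZMod (p ^ a) × ZMod (q ^ b)) (hf : IsFactorial f) :
    ∑ i, invOrder (f i) ≤
      1 + ∑ j ∈ Finset.range a, 1 / (p : ℝ) ^ j + ∑ j ∈ Finset.range b, 1 / (q : ℝ) ^ j := by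
  induction b with
  | zero =>
    induction a, ha using Nat.le_induction with
    | base =>
      refine (sum_invOrder_le_base hp hf).trans_eq ?_
      norm_num
    | succ a ha ih =>
      rw [Finset.sum_range_succ]
      have := sum_invOrder_le_succ_left hp hq hpq ha ih hf
      linarith
  | succ b ih =>
    rw [Finset.sum_range_succ _ b]
    have := sum_invOrder_le_succ_right hp hq hpq ha ih hf
    linarith

end UpperBound

/-! ### Families that attain the bound -/

section Construction

variable {G : Type*} [AddCommGroup G]

/-- Some factorial family of nonzero elements of `K` has cross number `k`. -/
def HasFactorialFamily (K : AddSubgroup G) (k : ℝ) : Prop :=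
  ∃ (ι : Type) (_ : Fintype ι) (_ : DecidableEq ι) (f : ι → G),
    IsFactorial f ∧ (∀ i, f i ≠ 0) ∧ (∀ i, f i ∈ K) ∧ ∑ i, invOrder (f i) = k

theorem HasFactorialFamily.bot : HasFactorialFamily (⊥ : AddSubgroup G) 0 :=
  ⟨Empty, inferInstance, inferInstance, Empty.elim, by simp [IsFactorial], by simp, by simp,
    by simp⟩

theorem HasFactorialFamily.mono {K L : AddSubgroup G} (hKL : K ≤ L) {k : ℝ}
    (h : HasFactorialFamily K k) : HasFactorialFamily L k := by
  obtain ⟨ι, i1, i2, f, h1, h2, h3, h4⟩ := h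
  exact ⟨ι, i1, i2, f, h1, h2, fun i => hKL (h3 i), h4⟩

/-- If `h` has order `p` modulo `K`, then `p - 1` copies of `h` together with `-(p - 1) • h` form
one more atom. -/
theorem HasFactorialFamily.extend {p γ : ℕ} (hp : p.Prime) {K : AddSubgroup G} {k : ℝ}
    (hk : HasFactorialFamily K k) {h : G} (ho : addOrderOf h = p ^ (γ + 1))
    (hK : ∀ c : ℤ, c • h ∈ K → (p : ℤ) ∣ c) :
    HasFactorialFamily (K ⊔ AddSubgroup.zmultiples h) (k + 1 / p ^ γ) := by
  have : NeZero p := ⟨hp.ne_zero⟩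
  obtain ⟨κ, _, _, f, hf, hf0, hfK, hfk⟩ := hk
  -- index `0` carries the exceptional term
  let g : Fin p → G := fun j => if j = 0 then -((p - 1) • h) else h
  have hgsum : ∀ B : Finset (Fin p), ∑ j ∈ B, g j =
      ((B.card : ℤ) - if (0 : Fin p) ∈ B then (p : ℤ) else 0) • h := by
    intro B
    have hg : ∀ j, g j = h - if j = 0 then (p : ℤ) • h else 0 := by
      intro j
      simp only [g]
      split_ifs
      · rw [natCast_zsmul]
        conv_rhs => rw [← Nat.sub_add_cancel hp.one_le, succ_nsmul]
        abel
      · rw [sub_zero]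
    simp only [hg]
    rw [Finset.sum_sub_distrib, Finset.sum_const, Finset.sum_ite_eq', sub_smul, natCast_zsmul]
    split_ifs <;> simp
  have hg0 : ∀ B : Finset (Fin p), ∑ j ∈ B, g j ∈ K → B = ∅ ∨ B = Finset.univ := by
    intro B hB
    rw [hgsum] at hB
    have hd : (p : ℤ) ∣ B.card := by
      have := hK _ hB
      split_ifs at this
      · simpa using this
      · simpa using this
    rw [Int.natCast_dvd_natCast] at hd
    rcases Nat.eq_zero_or_pos B.card with h0 | h0
    · exact Or.inl (Finset.card_eq_zero.1 h0)
    · right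
      have hle := Nat.le_of_dvd h0 hd
      rw [← Finset.card_eq_iff_eq_univ, Fintype.card_fin]
      exact (B.card_le_univ.trans_eq (Fintype.card_fin p)).antisymm hle
  have hguniv : ∑ j, g j = 0 := by
    rw [hgsum]
    simp
  have hord : ∀ j, addOrderOf (g j) = p ^ (γ + 1) := by
    intro j
    simp only [g]
    split_ifs
    · rw [addOrderOf_neg, Nat.Coprime.addOrderOf_nsmul, ho]
      rw [ho]
      refine Nat.Coprime.pow_left _ ((Nat.Prime.coprime_iff_not_dvd hp).2 fun hd => ?_)
      have := Nat.le_of_dvd (by have := hp.two_le; omega) hd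
      have := hp.two_le
      omega
    · exact ho
  have hgne : ∀ j, g j ≠ 0 := by
    intro j hj
    have := hord j
    rw [hj, addOrderOf_zero] at this
    exact (Nat.one_lt_pow γ.succ_ne_zero hp.one_lt).ne this
  have hsum : ∀ A : Finset (κ ⊕ Fin p), ∑ i ∈ A, Sum.elim f g i =
      ∑ i ∈ A.toLeft, f i + ∑ j ∈ A.toRight, g j := by
    intro A
    conv_lhs => rw [← Finset.toLeft_disjSum_toRight (u := A)]
    rw [Finset.sum_disjSum]
    simp
  have hzero : ∀ A : Finset (κ ⊕ Fin p), ∑ i ∈ A, Sum.elim f g i = 0 →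
      ∑ i ∈ A.toLeft, f i = 0 ∧ (A.toRight = ∅ ∨ A.toRight = Finset.univ) := by
    intro A hA
    rw [hsum] at hA
    have hright := hg0 A.toRight (by
      rw [← neg_eq_of_add_eq_zero_right hA]
      exact neg_mem (sum_mem fun i _ => hfK i))
    refine ⟨?_, hright⟩
    rcases hright with h0 | h0
    · rwa [h0, Finset.sum_empty, add_zero] at hA
    · rwa [h0, hguniv, add_zero] at hA
  refine ⟨κ ⊕ Fin p, inferInstance, inferInstance, Sum.elim f g, ⟨?_, fun A B hA hB => ?_⟩,
    ?_, ?_, ?_⟩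
  · rw [Fintype.sum_sum_type]
    simp [hf.1, hguniv]
  · obtain ⟨hA1, hA2⟩ := hzero A hA
    obtain ⟨hB1, hB2⟩ := hzero B hB
    rw [hsum, Finset.toLeft_inter, Finset.toRight_inter, hf.2 _ _ hA1 hB1, zero_add]
    rcases hA2 with h | h <;> rcases hB2 with h' | h' <;> simp [h, h', hguniv]
  · rintro (i | j)
    · exact hf0 i
    · exact hgne j
  · rintro (i | j)
    · exact AddSubgroup.mem_sup_left (hfK i)
    · refine AddSubgroup.mem_sup_right ?_
      have hh := AddSubgroup.mem_zmultiples h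
      simp only [Sum.elim_inr, g]
      split_ifs
      · exact neg_mem (nsmul_mem hh _)
      · exact hh
  · rw [Fintype.sum_sum_type]
    simp only [Sum.elim_inl, Sum.elim_inr, hfk, invOrder_of_ne_zero (hgne _), hord]
    have hp0 : (p : ℝ) ≠ 0 := by exact_mod_cast hp.ne_zero
    rw [Finset.sum_const, Finset.card_univ, Fintype.card_fin, nsmul_eq_mul, pow_succ]
    push_cast
    field_simp

theorem HasFactorialFamily.sup_zmultiples {p : ℕ} (hp : p.Prime) {K : AddSubgroup G} {k : ℝ}
    (hk : HasFactorialFamily K k) {γ : ℕ} {h : G} (ho : addOrderOf h = p ^ γ)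
    (hK : ∀ c : ℤ, c • h ∈ K → c • h = 0) :
    HasFactorialFamily (K ⊔ AddSubgroup.zmultiples h)
      (k + ∑ j ∈ Finset.range γ, 1 / (p : ℝ) ^ j) := by
  induction γ generalizing h with
  | zero =>
    rw [Finset.sum_range_zero, add_zero]
    exact hk.mono le_sup_left
  | succ γ ih =>
    have ho' : addOrderOf (p • h) = p ^ γ := by
      rw [addOrderOf_nsmul' h hp.ne_zero, ho, pow_succ, Nat.gcd_mul_left_left,
        Nat.mul_div_cancel _ hp.pos]
    have h1 := ih ho' fun c hc => by
      rw [← natCast_zsmul, smul_smul] at hc ⊢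
      exact hK _ hc
    have h2 := h1.extend hp ho fun c hc => by
      obtain ⟨x, hx, y, hy, hxy⟩ := AddSubgroup.mem_sup.1 hc
      obtain ⟨m, rfl⟩ := AddSubgroup.mem_zmultiples_iff.1 hy
      have hx' : x = (c - m * p) • h := by
        rw [sub_smul, ← hxy, mul_smul, natCast_zsmul]
        abel
      rw [hx'] at hx
      have h0 := addOrderOf_dvd_iff_zsmul_eq_zero.2 (hK _ hx)
      rw [ho] at h0
      have h3 : (p : ℤ) ∣ c - m * p := by
        refine dvd_trans ?_ h0
        exact_mod_cast dvd_pow_self p γ.succ_ne_zero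
      simpa using dvd_add h3 (dvd_mul_left (p : ℤ) m)
    rw [Finset.sum_range_succ, ← add_assoc]
    refine h2.mono (sup_le (sup_le le_sup_left ?_) le_sup_right)
    rw [AddSubgroup.zmultiples_le]
    exact AddSubgroup.mem_sup_right (nsmul_mem (AddSubgroup.mem_zmultiples h) p)

theorem hasFactorialFamily_top {p q : ℕ} (hp : p.Prime) (hq : q.Prime) (a b : ℕ) :
    HasFactorialFamily (⊤ : AddSubgroup (ZMod p × ZMod (p ^ a) × ZMod (q ^ b)))
      (1 + ∑ j ∈ Finset.range a, 1 / (p : ℝ) ^ j + ∑ j ∈ Finset.range b, 1 / (q : ℝ) ^ j) := by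
  let H := ZMod p × ZMod (p ^ a) × ZMod (q ^ b)
  have ho1 : addOrderOf ((1, 0, 0) : H) = p ^ 1 := by
    rw [Prod.addOrderOf, ZMod.addOrderOf_one]
    show p.lcm (addOrderOf (0 : ZMod (p ^ a) × ZMod (q ^ b))) = p ^ 1
    simp
  have ho2 : addOrderOf ((0, 1, 0) : H) = p ^ a := by
    rw [Prod.addOrderOf, Prod.addOrderOf, ZMod.addOrderOf_one]
    simp
  have ho3 : addOrderOf ((0, 0, 1) : H) = q ^ b := by
    rw [Prod.addOrderOf, Prod.addOrderOf, ZMod.addOrderOf_one]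
    simp
  have h1 := (HasFactorialFamily.bot (G := H)).sup_zmultiples hp ho1 (fun c hc => by simpa using hc)
  have h1' := h1.mono (L := (AddMonoidHom.snd (ZMod p) (ZMod (p ^ a) × ZMod (q ^ b))).ker) (by
    rw [bot_sup_eq, AddSubgroup.zmultiples_le]
    rfl)
  have h2 := h1'.sup_zmultiples hp ho2 (fun c hc => by
    have hc' : (c • ((0, 1, 0) : H)).2 = 0 := hc
    refine Prod.ext ?_ hc'
    simp)
  have h2' := h2.mono (L := ((AddMonoidHom.snd (ZMod (p ^ a)) (ZMod (q ^ b))).comp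
      (AddMonoidHom.snd (ZMod p) _)).ker) (by
    rw [sup_le_iff, AddSubgroup.zmultiples_le]
    refine ⟨fun x hx => ?_, rfl⟩
    have hx' : x.2 = 0 := hx
    rw [AddMonoidHom.mem_ker]
    simp [hx'])
  have h3 := h2'.sup_zmultiples hq ho3 (fun c hc => by
    have hc' : (c • ((0, 0, 1) : H)).2.2 = 0 := hc
    refine Prod.ext ?_ (Prod.ext ?_ hc') <;> simp)
  have := h3.mono (le_top)
  rw [Finset.sum_range_one, pow_zero, div_one, zero_add] at this
  exact this

end Construction

/-! ### Unique factorization indexed sequences and factorial families -/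

section Indexed

universe u

variable {G : Type u} [AddCommGroup G]

namespace IndexedSeq

theorem sigma_zero : IndexedSeq.sigma (0 : IndexedSeq G) = 0 := by
  simp [IndexedSeq.sigma]

theorem sigma_add (S T : IndexedSeq G) : IndexedSeq.sigma (S + T) = S.sigma + T.sigma := by
  simp [IndexedSeq.sigma]

theorem exists_isIrreducible_le (S : IndexedSeq G) (hS : S.sigma = 0) (hne : S ≠ 0) :
    ∃ U ≤ S, IsIrreducible U := by
  induction S using Multiset.strongInductionOn with
  | ih S ih =>
    by_cases h : IndexedSeq.IsIrreducible S
    · exact ⟨S, le_rfl, h⟩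
    · simp only [IsIrreducible, not_and] at h
      have h' := h hne hS
      push Not at h'
      obtain ⟨T, hTS, hT0, hTs, hTne⟩ := h'
      obtain ⟨U, hU, hU'⟩ := ih T (lt_of_le_of_ne hTS hTne) hTs hT0
      exact ⟨U, hU.trans hTS, hU'⟩

theorem factorizations_nonempty (S : IndexedSeq G) (hS : S.sigma = 0) :
    ∃ F, F ∈ S.factorizations := by
  classical
  induction S using Multiset.strongInductionOn with
  | ih S ih =>
    by_cases h0 : S = 0
    · exact ⟨0, by simp [factorizations, h0]⟩
    · obtain ⟨U, hUS, hU⟩ := exists_isIrreducible_le S hS h0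
      have hadd : U + (S - U) = S := add_tsub_cancel_of_le hUS
      have hs : IndexedSeq.sigma (S - U) = 0 := by
        rw [← hadd, sigma_add, hU.2.1, zero_add] at hS
        exact hS
      have hlt : S - U < S := by
        refine lt_of_le_of_ne tsub_le_self fun h => hU.1 ?_
        rw [h] at hadd
        simpa using hadd
      obtain ⟨F, hF⟩ := ih (S - U) hlt hs
      refine ⟨⟨U, hU⟩ ::ₘ F, ?_⟩
      have hF' : (F.map Subtype.val).sum = S - U := hF
      show (Multiset.map Subtype.val (⟨U, hU⟩ ::ₘ F)).sum = S
      rw [Multiset.map_cons, Multiset.sum_cons, hF', hadd]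

/-- By unique factorization a zero-sum divisor of `S` is the product of a subfamily of the factors
of `S`, and an intersection of two such divisors is the product of the common factors. -/
theorem IsUFIS.sigma_inter [DecidableEq ({g : G // g ≠ 0} × ℕ)] {S : IndexedSeq G} (hS : S.IsUFIS)
    {A B : IndexedSeq G} (hA : A ≤ S) (hB : B ≤ S) (hA0 : A.sigma = 0) (hB0 : B.sigma = 0) :
    IndexedSeq.sigma (A ∩ B) = 0 := by
  classical
  obtain ⟨hnd, hS0, F, hF, huniq⟩ := hS
  have hcompl : ∀ T : IndexedSeq G, T ≤ S → T.sigma = 0 → ∃ F₁ F₂, F₁ ∈ T.factorizations ∧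
      F₂ ∈ IndexedSeq.factorizations (S - T) ∧ F₁ + F₂ = F := by
    intro T hT hT0
    have hadd : T + (S - T) = S := add_tsub_cancel_of_le hT
    have hs : IndexedSeq.sigma (S - T) = 0 := by
      have hS0' := hS0
      rw [← hadd, sigma_add, hT0, zero_add] at hS0'
      exact hS0'
    obtain ⟨F₁, h₁⟩ := factorizations_nonempty T hT0
    obtain ⟨F₂, h₂⟩ := factorizations_nonempty (S - T) hs
    refine ⟨F₁, F₂, h₁, h₂, huniq _ ?_⟩
    have h₁' : (F₁.map Subtype.val).sum = T := h₁
    have h₂' : (F₂.map Subtype.val).sum = S - T := h₂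
    show (Multiset.map Subtype.val (F₁ + F₂)).sum = S
    rw [Multiset.map_add, Multiset.sum_add, h₁', h₂', hadd]
  obtain ⟨FB, FB', hFB, hFB', hFBF⟩ := hcompl B hB hB0
  obtain ⟨FA, FA', hFA, -, hFAF⟩ := hcompl A hA hA0
  have hprod : ∀ {F₁ F₂ : Multiset {U : IndexedSeq G // U.IsIrreducible}}, F₁ ≤ F₂ →
      (F₁.map Subtype.val).sum ≤ (F₂.map Subtype.val).sum := by
    intro F₁ F₂ h
    rw [← add_tsub_cancel_of_le h, Multiset.map_add, Multiset.sum_add]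
    exact le_self_add
  have hCB := hprod (Multiset.inter_le_right : FA ∩ FB ≤ FB)
  have hD : FA - FB ≤ FB' := by
    have h1 : FA ≤ FB + FB' := by
      rw [hFBF, ← hFAF]
      exact le_self_add
    exact tsub_le_iff_left.2 h1
  have hDB := hprod hD
  have hsplit : FA - FB + FA ∩ FB = FA := Multiset.sub_add_inter FA FB
  have hA' : ((FA - FB).map Subtype.val).sum + ((FA ∩ FB).map Subtype.val).sum = A := by
    rw [← Multiset.sum_add, ← Multiset.map_add, hsplit]
    exact hFA
  have hFB1 : (FB.map Subtype.val).sum = B := hFB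
  have hFB2 : (FB'.map Subtype.val).sum = S - B := hFB'
  rw [hFB1] at hCB
  rw [hFB2] at hDB
  have hinter : A ∩ B = ((FA ∩ FB).map Subtype.val).sum := by
    ext x
    have c1 := congrArg (Multiset.count x) hA'
    have c2 := Multiset.count_le_of_le x hCB
    have c3 := Multiset.count_le_of_le x hDB
    have c4 := Multiset.nodup_iff_count_le_one.1 hnd x
    have c5 := Multiset.count_le_of_le x hB
    have c6 := Multiset.count_le_of_le x hA
    rw [Multiset.count_add] at c1
    rw [Multiset.count_sub] at c3
    rw [Multiset.count_inter]
    omega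
  rw [hinter]
  have hs : ∀ F : Multiset {U : IndexedSeq G // U.IsIrreducible},
      IndexedSeq.sigma (F.map Subtype.val).sum = 0 := by
    intro F
    induction F using Multiset.induction_on with
    | empty => simp [sigma_zero]
    | cons U F ih => rw [Multiset.map_cons, Multiset.sum_cons, sigma_add, ih, U.2.2.1, zero_add]
  exact hs _

theorem isUFIS_of_sigma_inter [DecidableEq ({g : G // g ≠ 0} × ℕ)] {S : IndexedSeq G}
    (hnd : S.Nodup) (hS : S.sigma = 0)
    (h : ∀ A B : IndexedSeq G, A ≤ S → B ≤ S → A.sigma = 0 → B.sigma = 0 →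
      IndexedSeq.sigma (A ∩ B) = 0) : S.IsUFIS := by
  have hle : ∀ F ∈ S.factorizations, ∀ U ∈ F, U.val ≤ S := by
    intro F hF U hU
    have hF' : (F.map Subtype.val).sum = S := hF
    rw [← hF']
    exact Multiset.single_le_sum (fun _ _ => zero_le) _ (Multiset.mem_map_of_mem _ hU)
  have hFnd : ∀ F ∈ S.factorizations, F.Nodup := by
    intro F hF
    rw [Multiset.nodup_iff_le]
    intro U hU
    obtain ⟨F', rfl⟩ := Multiset.le_iff_exists_add.1 hU
    have hF' : (Multiset.map Subtype.val (U ::ₘ U ::ₘ 0 + F')).sum = S := hF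
    obtain ⟨x, hx⟩ := Multiset.exists_mem_of_ne_zero U.2.1
    have hc := Multiset.nodup_iff_count_le_one.1 hnd x
    have hx' := Multiset.one_le_count_iff_mem.2 hx
    rw [← hF'] at hc
    simp only [Multiset.map_add, Multiset.map_cons, Multiset.map_zero, Multiset.sum_add,
      Multiset.sum_cons, Multiset.sum_zero, add_zero, Multiset.count_add] at hc
    omega
  have hsub : ∀ F ∈ S.factorizations, ∀ F' ∈ S.factorizations, ∀ U ∈ F, U ∈ F' := by
    intro F hF F' hF' U hU
    obtain ⟨x, hx⟩ := Multiset.exists_mem_of_ne_zero U.2.1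
    have hxS : x ∈ S := Multiset.mem_of_le (hle F hF U hU) hx
    have hS' : (F'.map Subtype.val).sum = S := hF'
    rw [← hS'] at hxS
    obtain ⟨V, hV, hxV⟩ := Multiset.mem_join.1 hxS
    obtain ⟨U', hU', rfl⟩ := Multiset.mem_map.1 hV
    have h0 : IndexedSeq.sigma (U.val ∩ U'.val) = 0 :=
      h _ _ (hle F hF U hU) (hle F' hF' U' hU') U.2.2.1 U'.2.2.1
    have hne : U.val ∩ U'.val ≠ 0 := fun h => by
      have := Multiset.mem_inter.2 ⟨hx, hxV⟩
      rw [h] at this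
      exact Multiset.notMem_zero x this
    have h1 := U.2.2.2 _ Multiset.inter_le_left hne h0
    have h2 := U'.2.2.2 _ Multiset.inter_le_right hne h0
    rwa [Subtype.ext (h1.symm.trans h2)]
  obtain ⟨F, hF⟩ := factorizations_nonempty S hS
  refine ⟨hnd, hS, F, hF, fun F' hF' => ?_⟩
  exact ((hFnd F' hF').ext (hFnd F hF)).2 fun U =>
    ⟨hsub F' hF' F hF U, hsub F hF F' hF' U⟩

/-- The terms of a UFIS form a factorial family. -/
theorem IsUFIS.exists_isFactorial {S : IndexedSeq G} (hS : S.IsUFIS) :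
    ∃ (ι : Type u) (_ : Fintype ι) (_ : DecidableEq ι) (f : ι → G),
      IsFactorial f ∧ ∑ i, invOrder (f i) = S.crossNumber := by
  classical
  let X : Finset ({g : G // g ≠ 0} × ℕ) := ⟨S, hS.1⟩
  have hsum : ∀ A : Finset X, ∑ i ∈ A, (i.1.1 : G) =
      IndexedSeq.sigma (A.map (Function.Embedding.subtype _)).val := by
    intro A
    rw [IndexedSeq.sigma, Finset.map_val, Multiset.map_map]
    rfl
  have hle : ∀ A : Finset X, (A.map (Function.Embedding.subtype _)).val ≤ S := by
    intro A
    refine Finset.val_le_iff.2 (show _ ⊆ X from fun x hx => ?_)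
    obtain ⟨i, -, rfl⟩ := Finset.mem_map.1 hx
    exact i.2
  refine ⟨X, inferInstance, inferInstance, fun i => (i.1.1 : G), ⟨?_, fun A B hA hB => ?_⟩, ?_⟩
  · rw [Finset.univ_eq_attach, Finset.sum_attach X (fun x => (x.1 : G))]
    exact hS.2.1
  · rw [hsum] at hA hB ⊢
    rw [Finset.map_inter, Finset.inter_val]
    exact hS.sigma_inter (hle A) (hle B) hA hB
  · rw [Finset.univ_eq_attach, Finset.sum_attach X (fun x => invOrder (x.1 : G))]
    rw [IndexedSeq.crossNumber]
    exact Finset.sum_congr rfl fun x _ => invOrder_of_ne_zero x.1.2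

end IndexedSeq

/-- A factorial family of nonzero elements, with distinct labels, is a UFIS. -/
theorem IsFactorial.exists_isUFIS {ι : Type*} [Fintype ι] [DecidableEq ι] {f : ι → G}
    (hf : IsFactorial f) (h0 : ∀ i, f i ≠ 0) :
    ∃ S : IndexedSeq G, S.IsUFIS ∧ S.crossNumber = ∑ i, invOrder (f i) := by
  classical
  let φ : ι ↪ {g : G // g ≠ 0} × ℕ :=
    ⟨fun i => (⟨f i, h0 i⟩, (Fintype.equivFin ι i : ℕ)), fun i j hij => by
      have := (Prod.ext_iff.1 hij).2
      exact (Fintype.equivFin ι).injective (Fin.ext this)⟩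
  have hsum : ∀ A : Finset ι, IndexedSeq.sigma (A.map φ).val = ∑ i ∈ A, f i := by
    intro A
    rw [IndexedSeq.sigma, Finset.map_val, Multiset.map_map]
    rfl
  refine ⟨(Finset.univ.map φ).val, IndexedSeq.isUFIS_of_sigma_inter (Finset.nodup _) ?_ ?_, ?_⟩
  · rw [hsum, hf.1]
  · have hex : ∀ A : IndexedSeq G, A ≤ (Finset.univ.map φ).val →
        ∃ u : Finset ι, A = (u.map φ).val := by
      intro A hA
      have hnd : A.Nodup := Multiset.nodup_of_le hA (Finset.nodup _)
      obtain ⟨u, -, hu⟩ := Finset.subset_map_iff.1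
        (Finset.val_le_iff.1 (show (⟨A, hnd⟩ : Finset _).val ≤ (Finset.univ.map φ).val from hA))
      exact ⟨u, congrArg Finset.val hu⟩
    intro A B hA hB hA0 hB0
    obtain ⟨u, rfl⟩ := hex A hA
    obtain ⟨v, rfl⟩ := hex B hB
    rw [hsum] at hA0 hB0
    rw [← Finset.inter_val, ← Finset.map_inter, hsum]
    exact hf.2 u v hA0 hB0
  · simp only [invOrder_of_ne_zero (h0 _)]
    rw [IndexedSeq.crossNumber, Finset.map_val, Multiset.map_map]
    rfl

end Indexed

/-! ### The value of `K₁*` and the conclusion -/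

theorem K1Star_eq_sum {p q α β : ℕ} (hp : p.Prime) (hq : q.Prime) (hα : 0 < α) (hβ : 0 < β)
    {G : Type*} [AddCommGroup G] [Finite G] (e : G ≃+ ZMod p × ZMod (p ^ α) × ZMod (q ^ β)) :
    K1Star G =
      1 + ∑ j ∈ Finset.range α, 1 / (p : ℝ) ^ j + ∑ j ∈ Finset.range β, 1 / (q : ℝ) ^ j := by
  have hgeom : ∀ {l n : ℕ}, l.Prime → 0 < n →
      ((l : ℝ) ^ n - 1) / ((l : ℝ) ^ n - (l : ℝ) ^ (n - 1)) =
        ∑ j ∈ Finset.range n, 1 / (l : ℝ) ^ j := by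
    intro l n hl hn
    obtain ⟨k, rfl⟩ : ∃ k, n = k + 1 := ⟨n - 1, by omega⟩
    have hl1 : (1 : ℝ) < l := by exact_mod_cast hl.one_lt
    have hl0 : (l : ℝ) ≠ 0 := by positivity
    have hl2 : (l : ℝ) - 1 ≠ 0 := by linarith
    have h1 : (l : ℝ) ^ (k + 1) - (l : ℝ) ^ k = (l : ℝ) ^ k * (l - 1) := by ring
    rw [Nat.add_sub_cancel, h1, div_eq_iff (mul_ne_zero (pow_ne_zero _ hl0) hl2),
      ← mul_geom_sum, ← Finset.sum_range_reflect, Finset.mul_sum, Finset.sum_mul]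
    refine Finset.sum_congr rfl fun j hj => ?_
    have hj' : j ≤ k := by
      rw [Finset.mem_range] at hj
      omega
    have h2 : (l : ℝ) ^ k = (l : ℝ) ^ (k - j) * (l : ℝ) ^ j := by
      rw [← pow_add, Nat.sub_add_cancel hj']
    rw [Nat.add_sub_cancel, h2]
    field_simp
  let P : Fin 3 → ℕ := ![p, p, q]
  let E : Fin 3 → ℕ := ![1, α, β]
  let e' : ZMod p × ZMod (p ^ α) × ZMod (q ^ β) ≃+ ((i : Fin 3) → ZMod (P i ^ E i)) :=
    { toFun := fun g => Fin.cons ((ZMod.ringEquivCongr (pow_one p).symm) g.1)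
        (Fin.cons (α := fun i : Fin 2 => ZMod (P i.succ ^ E i.succ)) g.2.1
          (Fin.cons (α := fun i : Fin 1 => ZMod (P i.succ.succ ^ E i.succ.succ)) g.2.2
            finZeroElim))
      invFun := fun x => ((ZMod.ringEquivCongr (pow_one p).symm).symm (x 0), x 1, x 2)
      left_inv := fun g => Prod.ext (RingEquiv.symm_apply_apply _ _) rfl
      right_inv := fun x => by
        funext i
        fin_cases i
        · exact RingEquiv.apply_symm_apply _ _
        · rfl
        · rfl
      map_add' := fun g h => by
        funext i
        fin_cases i
        · exact map_add (ZMod.ringEquivCongr (pow_one p).symm) g.1 h.1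
        · rfl
        · rfl }
  have hdec : IsPrimaryDecomposition G P E := by
    refine ⟨?_, ?_, ⟨e.trans e'⟩⟩
    · intro i
      fin_cases i <;> assumption
    · intro i
      fin_cases i
      · exact Nat.one_pos
      · exact hα
      · exact hβ
  rw [K1Star_eq hdec, K1StarSum, Fin.sum_univ_three]
  show ((p : ℝ) ^ 1 - 1) / ((p : ℝ) ^ 1 - (p : ℝ) ^ (1 - 1)) +
    ((p : ℝ) ^ α - 1) / ((p : ℝ) ^ α - (p : ℝ) ^ (α - 1)) +
    ((q : ℝ) ^ β - 1) / ((q : ℝ) ^ β - (q : ℝ) ^ (β - 1)) = _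
  rw [hgeom hp Nat.one_pos, hgeom hp hα, hgeom hq hβ]
  simp

end CrossNumber

/-- If `p`, `q` are distinct primes, `α`, `β` are positive integers and `G` is (isomorphic to)
`C_p ⊕ C_{p^α} ⊕ C_{q^β}`, then the maximum that defines `K₁(G)` is attained, and
`K₁(G) = K₁*(G)`. -/
theorem mainTheorem8 (p q α β : ℕ) (hp : p.Prime) (hq : q.Prime) (hpq : p ≠ q)
    (hα : 0 < α) (hβ : 0 < β) (G : Type*) [AddCommGroup G] [Finite G]
    (hG : Nonempty (G ≃+ ZMod p × ZMod (p ^ α) × ZMod (q ^ β))) :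
    IsGreatest (CrossNumber.ufisCrossNumbers G) (CrossNumber.K1 G) ∧
      CrossNumber.K1 G = CrossNumber.K1Star G := by
  obtain ⟨e⟩ := hG
  have hgreat : IsGreatest (CrossNumber.ufisCrossNumbers G) (CrossNumber.K1Star G) := by
    rw [CrossNumber.K1Star_eq_sum hp hq hα hβ e]
    constructor
    · obtain ⟨ι, _, _, f, hf, hf0, -, hk⟩ := CrossNumber.hasFactorialFamily_top hp hq α β
      have hinj : Function.Injective e.symm.toAddMonoidHom := e.symm.injective
      obtain ⟨S, hS, hSk⟩ := ((CrossNumber.IsFactorial.comp_injective_iff hinj).2 hf).exists_isUFIS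
        (fun i => (map_ne_zero_iff _ hinj).2 (hf0 i))
      refine ⟨S, hS, ?_⟩
      rw [hSk, ← hk]
      exact Finset.sum_congr rfl fun i _ => CrossNumber.invOrder_map_of_injective hinj (f i)
    · rintro _ ⟨S, hS, rfl⟩
      obtain ⟨ι, _, _, f, hf, hk⟩ := hS.exists_isFactorial
      have hinj : Function.Injective e.toAddMonoidHom := e.injective
      have := CrossNumber.sum_invOrder_le hp hq hpq hα β _
        ((CrossNumber.IsFactorial.comp_injective_iff hinj).2 hf)
      simp only [CrossNumber.invOrder_map_of_injective hinj] at this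
      rwa [hk] at this
  have hK : CrossNumber.K1 G = CrossNumber.K1Star G := hgreat.csSup_eq
  exact ⟨hK ▸ hgreat, hK⟩
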